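/- Let $n\ge 1$ and $G=\mathrm{PGL}(n,\mathbb C)$, acting on $L=\mathfrak{sl}(n,\mathbb C)$ by conjugation. A subgroup of $G$ is called diagonalizable if it is an algebraic (Zariski closed) subgroup which is abelian and consists of semisimple elements (elements that act semisimply on $L$). Let $K$ be a finite subgroup of $G$ which is maximal, with respect to inclusion, among the diagonalizable subgroups of $G$. For $\sigma,\tau\in K$ with preimages $\tilde\sigma,\tilde\tau\in \mathrm{GL}(n,\mathbb C)$, define $\langle\sigma,\tau\rangle\in\mathbb C^\times$ by $\tilde\sigma\tilde\tau\tilde\sigma^{-1}\tilde\tau^{-1}=\langle\sigma,\tau\rangle I_n$; this is an anti-symmetric bimultiplicative pairing on $K$, with $\langle\sigma,\sigma\rangle=1$ for all $\sigma$. Let $\mathrm{Sp}(K)$ be the group of all automorphisms of the group $K$ that preserve $\langle\,,\rangle$. Let $\Delta$ be the set of roots of $K$ in $L$, that is, of all characters $\gamma:K\to\mathbb C^\times$ such that $L_\gamma=\{X\in L : \sigma\cdot X=\gamma(\sigma)X \text{ for all } \sigma\in K\}$ is nonzero. Let $W_G(K)=N_G(K)/K$ be the Weyl group of $K$, which acts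 on $K$ by conjugation. Then: 1. The pairing $\langle\,,\rangle$ is nonsingular: if $\langle\sigma,\tau\rangle=1$ for all $\tau\in K$, then $\sigma=1$. Hence for every character $\gamma$ of $K$ there is a unique $\gamma^*\in K$ with $\gamma(\tau)=\langle\gamma^*,\tau\rangle$ for all $\tau\in K$. The transvection $s_\gamma\in\mathrm{Aut}(K)$ is given by $s_\gamma(\tau)=\tau\,(\gamma^*)^{-j}$, where $j\in\mathbb Z$ is such that $\gamma(\tau)=e^{2\pi i j/m}$ and $m$ is the order of $\gamma^*$. 2. The action of $W_G(K)$ on $K$ is faithful, and the image of $W_G(K)$ in $\mathrm{Aut}(K)$ is equal to $\mathrm{Sp}(K)$. 3. This group $W_G(K)=\mathrm{Sp}(K)$ is generated by the transvections $s_\gamma$ with $\gamma\in\Delta$, $\gamma\ne 1$. -/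

import Mathlib

/-! ## Symplectic abelian groups

Abelian groups are written multiplicatively: they are types with `[Group H] [IsMulCommutative H]`.
A pairing of `H` into `ℂˣ` is a bimultiplicative map, that is, an element of `H →* H →* ℂˣ`. -/

namespace SymplecticAbelian

section Pairings

variable {H : Type*} [Group H]

/-- `⟨a, b⟩ = ⟨b, a⟩⁻¹` for all `a`, `b`. -/
def IsAntisymmetric (B : H →* H →* ℂˣ) : Prop := ∀ a b, B a b = (B b a)⁻¹

/-- `⟨a, a⟩ = 1` for all `a`. -/
def IsAlternating (B : H →* H →* ℂˣ) : Prop := ∀ a, B a a = 1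

/-- If `⟨a, b⟩ = 1` for all `b`, then `a` is the identity. -/
def IsNonsingular (B : H →* H →* ℂˣ) : Prop := ∀ a, (∀ b, B a b = 1) → a = 1

/-- The isometry group `Sp(H)`: all automorphisms of the group `H` which preserve the pairing. -/
def isometryGroup (B : H →* H →* ℂˣ) : Subgroup (MulAut H) where
  carrier := {φ | ∀ a b, B (φ a) (φ b) = B a b}
  one_mem' := fun _ _ => rfl
  mul_mem' := fun {φ ψ} hφ hψ a b => (hφ (ψ a) (ψ b)).trans (hψ a b)
  inv_mem' := fun {φ} hφ a b => by
    have h := hφ (φ⁻¹ a) (φ⁻¹ b)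
    rw [MulAut.apply_inv_self, MulAut.apply_inv_self] at h
    exact h.symm

end Pairings

/-- `ω_m = exp (2πi / m)` as a unit of `ℂ`. -/
noncomputable def omega (m : ℕ) : ℂˣ :=
  Units.mk0 (Complex.exp (2 * Real.pi * Complex.I / m)) (Complex.exp_ne_zero _)

theorem omega_isPrimitiveRoot {m : ℕ} (hm : m ≠ 0) : IsPrimitiveRoot (omega m) m := by
  rw [← IsPrimitiveRoot.coe_units_iff]
  exact Complex.isPrimitiveRoot_exp m hm

section RootAction

variable {H : Type*} [Group H]

open Classical in
/-- The element `z · b` of `H`, where `z` is a power of `ω_m` and `m` is the order of `b`: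
by definition `ω_m ^ j · b = b ^ j` (see `rootSMul_omega_zpow`). It is `1` if `z` is not a power
of `ω_m`. -/
noncomputable def rootSMul (z : ℂˣ) (b : H) : H :=
  if h : ∃ j : ℤ, omega (orderOf b) ^ j = z then b ^ h.choose else 1

theorem rootSMul_omega_zpow [Finite H] (b : H) (j : ℤ) :
    rootSMul (omega (orderOf b) ^ j) b = b ^ j := by
  have h : ∃ i : ℤ, omega (orderOf b) ^ i = omega (orderOf b) ^ j := ⟨j, rfl⟩
  have hω := omega_isPrimitiveRoot (orderOf_pos b).ne'
  have h1 := h.choose_spec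
  rw [zpow_eq_zpow_iff_modEq, ← hω.eq_orderOf, ← zpow_eq_zpow_iff_modEq] at h1
  rw [rootSMul, dif_pos h]
  exact h1

theorem exists_omega_zpow [Finite H] (B : H →* H →* ℂˣ) (b a : H) :
    ∃ j : ℤ, omega (orderOf b) ^ j = B b a := by
  have : NeZero (orderOf b) := ⟨(orderOf_pos b).ne'⟩
  have hω := omega_isPrimitiveRoot (orderOf_pos b).ne'
  have h1 : B b a ^ orderOf b = 1 := by
    rw [← MonoidHom.pow_apply, ← map_pow, pow_orderOf_eq_one, map_one, MonoidHom.one_apply]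
  have h2 : B b a ∈ Subgroup.zpowers (omega (orderOf b)) := by
    rw [hω.zpowers_eq]
    exact h1
  exact h2

theorem rootSMul_mul [Finite H] (B : H →* H →* ℂˣ) (b a c : H) :
    rootSMul (B b (a * c)) b = rootSMul (B b a) b * rootSMul (B b c) b := by
  obtain ⟨i, hi⟩ := exists_omega_zpow B b a
  obtain ⟨j, hj⟩ := exists_omega_zpow B b c
  rw [map_mul, ← hi, ← hj, ← zpow_add, rootSMul_omega_zpow, rootSMul_omega_zpow,
    rootSMul_omega_zpow, zpow_add]

theorem pairing_rootSMul [Finite H] (B : H →* H →* ℂˣ) (hB : IsAlternating B) (b a : H) :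
    B b (rootSMul (B b a) b) = 1 := by
  obtain ⟨i, hi⟩ := exists_omega_zpow B b a
  rw [← hi, rootSMul_omega_zpow, map_zpow, hB, one_zpow]

end RootAction

section Transvections

variable {H : Type*} [Group H] [IsMulCommutative H] [Finite H]

/-- The transvection `s_b : a ↦ a - ⟨b, a⟩ · b` (in additive notation) of a finite abelian group
with an alternating pairing, as an automorphism of the group. -/
noncomputable def transvection (B : H →* H →* ℂˣ) (hB : IsAlternating B) (b : H) : MulAut H where
  toFun a := a * (rootSMul (B b a) b)⁻¹
  invFun a := a * rootSMul (B b a) b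
  left_inv a := by
    have h : B b (a * (rootSMul (B b a) b)⁻¹) = B b a := by
      rw [map_mul, map_inv, pairing_rootSMul B hB, inv_one, mul_one]
    simp only [h, inv_mul_cancel_right]
  right_inv a := by
    have h : B b (a * rootSMul (B b a) b) = B b a := by
      rw [map_mul, pairing_rootSMul B hB, mul_one]
    simp only [h, mul_inv_cancel_right]
  map_mul' a c := by
    rw [rootSMul_mul, mul_inv_rev, mul_assoc a c, mul_assoc a (rootSMul (B b a) b)⁻¹,
      mul_comm' (rootSMul (B b c) b)⁻¹, ← mul_assoc c, mul_comm' c, mul_assoc _ c]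

/-- For a nonsingular pairing on a finite abelian group, `a ↦ ⟨a, ·⟩` is an isomorphism from `H`
onto its character group. -/
theorem toCharacter_bijective (B : H →* H →* ℂˣ) (hB : IsNonsingular B) :
    Function.Bijective B := by
  have hinj : Function.Injective B := by
    rw [injective_iff_map_eq_one]
    intro a ha
    exact hB a fun b => by rw [ha, MonoidHom.one_apply]
  let _ : CommGroup H := { (inferInstance : Group H) with mul_comm := mul_comm' }
  have : NeZero (Monoid.exponent H) := ⟨Monoid.exponent_ne_zero_of_finite⟩
  have hcard : Nat.card (H →* ℂˣ) = Nat.card H :=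
    CommGroup.card_monoidHom_of_hasEnoughRootsOfUnity H ℂ
  have : Finite (H →* ℂˣ) := Nat.finite_of_card_ne_zero (hcard ▸ Nat.card_pos.ne')
  exact (Nat.bijective_iff_injective_and_card B).2 ⟨hinj, hcard.symm⟩

/-- The element `γ*` of `H` with `γ = ⟨γ*, ·⟩`. -/
noncomputable def dualElement (B : H →* H →* ℂˣ) (hB : IsNonsingular B) : (H →* ℂˣ) ≃* H :=
  (MulEquiv.ofBijective B (toCharacter_bijective B hB)).symm

theorem dualElement_spec (B : H →* H →* ℂˣ) (hB : IsNonsingular B) (γ : H →* ℂˣ) (a : H) :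
    B (dualElement B hB γ) a = γ a :=
  DFunLike.congr_fun ((MulEquiv.ofBijective B (toCharacter_bijective B hB)).apply_symm_apply γ) a

end Transvections

end SymplecticAbelian

/-! ## Diagonalizable subgroups of `PGL(n, ℂ)` -/

namespace PGLWeyl

open Matrix

/-- The projective general linear group `PGL(n, ℂ)`. -/
abbrev PGL (n : ℕ) : Type := Matrix.ProjGenLinGroup (Fin n) ℂ

/-- The projection `GL(n, ℂ) → PGL(n, ℂ)`. -/
abbrev proj {n : ℕ} : GL (Fin n) ℂ →* PGL n := Matrix.ProjGenLinGroup.mk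

section

attribute [local instance 100] LieRing.ofAssociativeRing

/-- The space `sl(n, ℂ)` of traceless matrices (the vector space which underlies Mathlib's Lie
algebra `LieAlgebra.SpecialLinear.sl`). -/
abbrev sln (n : ℕ) : Submodule ℂ (Matrix (Fin n) (Fin n) ℂ) :=
  (LieAlgebra.SpecialLinear.sl (Fin n) ℂ).toSubmodule

end

theorem mem_sln {n : ℕ} (X : Matrix (Fin n) (Fin n) ℂ) : X ∈ sln n ↔ X.trace = 0 := Iff.rfl

theorem conj_mem_sln {n : ℕ} (g : GL (Fin n) ℂ) (X : sln n) :
    (g : Matrix (Fin n) (Fin n) ℂ) * X.1 * ((g⁻¹ : GL (Fin n) ℂ) : Matrix (Fin n) (Fin n) ℂ)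
      ∈ sln n := by
  rw [mem_sln, Matrix.trace_mul_comm, ← Matrix.mul_assoc, ← Units.val_mul, inv_mul_cancel,
    Units.val_one, Matrix.one_mul]
  exact X.2

/-- The adjoint action `g · X = g X g⁻¹` of `GL(n, ℂ)` on `sl(n, ℂ)`. -/
def adGL (n : ℕ) : GL (Fin n) ℂ →* Module.End ℂ (sln n) where
  toFun g :=
    { toFun := fun X => ⟨_, conj_mem_sln g X⟩
      map_add' := fun X Y => Subtype.ext (by
        simp only [Submodule.coe_add, Matrix.mul_add, Matrix.add_mul])
      map_smul' := fun c X => Subtype.ext (by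
        simp only [Submodule.coe_smul, Matrix.mul_smul, Matrix.smul_mul, RingHom.id_apply]) }
  map_one' := LinearMap.ext fun X => Subtype.ext (by simp)
  map_mul' g h := LinearMap.ext fun X => Subtype.ext (by
    simp [Matrix.mul_assoc])

/-- The action of `PGL(n, ℂ)` on `sl(n, ℂ)` by (inner) automorphisms. -/
def Ad (n : ℕ) : PGL n →* Module.End ℂ (sln n) :=
  Matrix.ProjGenLinGroup.lift (adGL n) (MonoidHom.ext fun u => LinearMap.ext fun X => Subtype.ext (by
    change ((Matrix.GeneralLinearGroup.scalar (Fin n) u : GL (Fin n) ℂ) :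
      Matrix (Fin n) (Fin n) ℂ) * X.1 * _ = X.1
    rw [Matrix.GeneralLinearGroup.coe_scalar,
      (Matrix.scalar_commute _ (fun r => Commute.all _ r) X.1).eq,
      ← Matrix.GeneralLinearGroup.coe_scalar, Matrix.mul_assoc, ← Units.val_mul, mul_inv_cancel,
      Units.val_one, Matrix.mul_one]))

/-- A subset of `PGL(n, ℂ)` is Zariski closed if its preimage in `GL(n, ℂ)` is the set of
invertible matrices at which some family of polynomials in the matrix entries vanishes. -/
def IsZariskiClosed {n : ℕ} (S : Set (PGL n)) : Prop :=
  ∃ P : Set (MvPolynomial (Fin n × Fin n) ℂ), ∀ g : GL (Fin n) ℂ,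
    proj g ∈ S ↔ ∀ f ∈ P, MvPolynomial.eval (fun ij => g.1 ij.1 ij.2) f = 0

/-- A diagonalizable subgroup of `PGL(n, ℂ)`: an algebraic subgroup which is abelian and consists
of semisimple elements. Here `σ` is semisimple if it acts on `sl(n, ℂ)` by a semisimple
(equivalently, diagonalizable) endomorphism. -/
structure IsDiagonalizable {n : ℕ} (K : Subgroup (PGL n)) : Prop where
  isZariskiClosed : IsZariskiClosed (K : Set (PGL n))
  isMulCommutative : IsMulCommutative K
  isSemisimple : ∀ σ ∈ K, (Ad n σ).IsSemisimple

/-- A maximal diagonalizable subgroup: one that is maximal, with respect to inclusion, among all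
diagonalizable subgroups. -/
def IsMaximalDiagonalizable {n : ℕ} (K : Subgroup (PGL n)) : Prop :=
  Maximal IsDiagonalizable K

/-! ### The commutator pairing -/

theorem scalar_mul_comm {n : ℕ} (u : ℂˣ) (g : GL (Fin n) ℂ) :
    Matrix.GeneralLinearGroup.scalar (Fin n) u * g =
      g * Matrix.GeneralLinearGroup.scalar (Fin n) u :=
  Units.ext (Matrix.scalar_commute _ (fun r => Commute.all _ r) g.1)

section Pairing

variable {n : ℕ} (K : Subgroup (PGL n)) [IsMulCommutative K]

theorem exists_commutatorScalar (σ τ : K) :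
    ∃ l : ℂˣ, ∀ g h : GL (Fin n) ℂ, proj g = σ → proj h = τ →
      g * h * g⁻¹ * h⁻¹ = Matrix.GeneralLinearGroup.scalar (Fin n) l := by
  obtain ⟨g₀, hg₀⟩ := Matrix.ProjGenLinGroup.mk_surjective (σ : PGL n)
  obtain ⟨h₀, hh₀⟩ := Matrix.ProjGenLinGroup.mk_surjective (τ : PGL n)
  have hc : ∀ (u : ℂˣ) (g : GL (Fin n) ℂ), Matrix.GeneralLinearGroup.scalar (Fin n) u * g =
      g * Matrix.GeneralLinearGroup.scalar (Fin n) u := fun u g => scalar_mul_comm u g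
  have h1 : proj (g₀ * h₀) = proj (h₀ * g₀) := by
    rw [map_mul, map_mul, hg₀, hh₀]
    exact congrArg Subtype.val (mul_comm' σ τ)
  obtain ⟨u, hu⟩ := Matrix.ProjGenLinGroup.mk_eq_mk_iff.1 h1.symm
  refine ⟨u, fun g h hg hh => ?_⟩
  obtain ⟨v, rfl⟩ := Matrix.ProjGenLinGroup.mk_eq_mk_iff.1 (hg₀.trans hg.symm)
  obtain ⟨w, rfl⟩ := Matrix.ProjGenLinGroup.mk_eq_mk_iff.1 (hh₀.trans hh.symm)
  rw [mul_inv_eq_iff_eq_mul, mul_inv_eq_iff_eq_mul]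
  calc g₀ * Matrix.GeneralLinearGroup.scalar (Fin n) v *
        (h₀ * Matrix.GeneralLinearGroup.scalar (Fin n) w)
      = g₀ * h₀ * Matrix.GeneralLinearGroup.scalar (Fin n) v *
        Matrix.GeneralLinearGroup.scalar (Fin n) w := by
        rw [mul_assoc g₀, ← mul_assoc _ h₀, hc v h₀]; simp only [mul_assoc]
    _ = h₀ * g₀ * Matrix.GeneralLinearGroup.scalar (Fin n) u *
        (Matrix.GeneralLinearGroup.scalar (Fin n) w *
          Matrix.GeneralLinearGroup.scalar (Fin n) v) := by
        rw [← hu, hc w, mul_assoc (h₀ * g₀ * _)]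
    _ = Matrix.GeneralLinearGroup.scalar (Fin n) u *
          (h₀ * (g₀ * Matrix.GeneralLinearGroup.scalar (Fin n) w) *
            Matrix.GeneralLinearGroup.scalar (Fin n) v) := by
        rw [← hc u]; simp only [mul_assoc]
    _ = _ := by
        rw [← hc w g₀]; simp only [mul_assoc]

/-- The scalar `⟨σ, τ⟩` such that `g h g⁻¹ h⁻¹ = ⟨σ, τ⟩ I` for all preimages `g`, `h` of `σ`, `τ`
in `GL(n, ℂ)`. -/
noncomputable def commutatorScalar (σ τ : K) : ℂˣ := (exists_commutatorScalar K σ τ).choose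

theorem commutatorScalar_spec (σ τ : K) {g h : GL (Fin n) ℂ} (hg : proj g = σ) (hh : proj h = τ) :
    g * h * g⁻¹ * h⁻¹ = Matrix.GeneralLinearGroup.scalar (Fin n) (commutatorScalar K σ τ) :=
  (exists_commutatorScalar K σ τ).choose_spec g h hg hh

variable [NeZero n]

theorem scalar_inj {l l' : ℂˣ} (h : Matrix.GeneralLinearGroup.scalar (Fin n) l =
    Matrix.GeneralLinearGroup.scalar (Fin n) l') : l = l' := by
  have h0 := congrArg (fun g : GL (Fin n) ℂ => g.1 0 0) h
  apply Units.ext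
  simpa using h0

theorem commutatorScalar_mul_left (σ σ' τ : K) : commutatorScalar K (σ * σ') τ =
    commutatorScalar K σ τ * commutatorScalar K σ' τ := by
  obtain ⟨g, hg⟩ := Matrix.ProjGenLinGroup.mk_surjective (σ : PGL n)
  obtain ⟨g', hg'⟩ := Matrix.ProjGenLinGroup.mk_surjective (σ' : PGL n)
  obtain ⟨h, hh⟩ := Matrix.ProjGenLinGroup.mk_surjective (τ : PGL n)
  apply scalar_inj (n := n)
  have hgg : proj (g * g') = ((σ * σ' : K) : PGL n) := by
    rw [map_mul, hg, hg', Subgroup.coe_mul]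
  rw [map_mul, ← commutatorScalar_spec K _ _ hgg hh, ← commutatorScalar_spec K _ _ hg hh]
  have h2 := commutatorScalar_spec K _ _ hg' hh
  have h3 : g * g' * h * (g * g')⁻¹ * h⁻¹ = g * (g' * h * g'⁻¹ * h⁻¹) * (h * g⁻¹ * h⁻¹) := by
    group
  rw [h3, h2, ← scalar_mul_comm, ← scalar_mul_comm]
  simp only [mul_assoc]

theorem commutatorScalar_swap (σ τ : K) : commutatorScalar K σ τ =
    (commutatorScalar K τ σ)⁻¹ := by
  obtain ⟨g, hg⟩ := Matrix.ProjGenLinGroup.mk_surjective (σ : PGL n)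
  obtain ⟨h, hh⟩ := Matrix.ProjGenLinGroup.mk_surjective (τ : PGL n)
  apply scalar_inj (n := n)
  rw [map_inv, ← commutatorScalar_spec K _ _ hg hh, ← commutatorScalar_spec K _ _ hh hg]
  group

theorem commutatorScalar_mul_right (σ τ τ' : K) : commutatorScalar K σ (τ * τ') =
    commutatorScalar K σ τ * commutatorScalar K σ τ' := by
  rw [commutatorScalar_swap, commutatorScalar_mul_left, mul_inv, ← commutatorScalar_swap,
    ← commutatorScalar_swap]

/-- The commutator pairing `⟨ , ⟩ : K × K → ℂˣ`. -/
noncomputable def commutatorPairing : K →* K →* ℂˣ :=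
  MonoidHom.mk' (fun σ => MonoidHom.mk' (commutatorScalar K σ) (commutatorScalar_mul_right K σ))
    fun σ σ' => MonoidHom.ext (commutatorScalar_mul_left K σ σ')

theorem commutatorPairing_antisymmetric :
    SymplecticAbelian.IsAntisymmetric (commutatorPairing K) := commutatorScalar_swap K

theorem commutatorPairing_alternating :
    SymplecticAbelian.IsAlternating (commutatorPairing K) := by
  intro σ
  obtain ⟨g, hg⟩ := Matrix.ProjGenLinGroup.mk_surjective (σ : PGL n)
  apply scalar_inj (n := n)
  rw [map_one]
  refine (commutatorScalar_spec K σ σ hg hg).symm.trans ?_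
  group

end Pairing

/-! ### Roots and the Weyl group -/

section Weyl

variable {n : ℕ} (K : Subgroup (PGL n))

/-- The homogeneous component `L_γ = {X | σ · X = γ(σ) X for all σ ∈ K}` of `L = sl(n, ℂ)`. -/
def rootSpace (γ : K →* ℂˣ) : Submodule ℂ (sln n) where
  carrier := {X | ∀ σ : K, Ad n σ X = (γ σ : ℂ) • X}
  add_mem' := fun hX hY σ => by rw [map_add, hX σ, hY σ, smul_add]
  zero_mem' := fun σ => by rw [map_zero, smul_zero]
  smul_mem' := fun c X hX σ => by rw [map_smul, hX σ, smul_comm]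

/-- The set `Δ(sl(n, ℂ), K)` of roots of a finite group `K` (all of whose characters are
algebraic). -/
def roots : Set (K →* ℂˣ) := {γ | rootSpace K γ ≠ ⊥}

/-- The Weyl group `W_G(K) = N_G(K) / K` with `G = PGL(n, ℂ)`. -/
abbrev WeylGroup : Type :=
  Subgroup.normalizer (K : Set (PGL n)) ⧸ K.subgroupOf (Subgroup.normalizer (K : Set (PGL n)))

/-- The action of the Weyl group of an abelian group `K` on `K` by conjugation. -/
def weylAction [IsMulCommutative K] : WeylGroup K →* MulAut K :=
  QuotientGroup.lift _ K.normalizerMonoidHom (by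
    rw [Subgroup.normalizerMonoidHom_ker]
    intro x hx
    rw [Subgroup.mem_subgroupOf] at hx ⊢
    rw [Subgroup.mem_centralizer_iff]
    intro y hy
    exact congrArg Subtype.val (mul_comm' (⟨y, hy⟩ : K) ⟨x, hx⟩))

end Weyl

end PGLWeyl

/-! The centralizer part rests on Schur's lemma. An element of finite order acts semisimply and
finite sets are Zariski closed, so maximality puts every finite-order element commuting with `K`
into `K`. Applied to `1 + (ω - 1) e` with `ω` of large prime order, this forces every idempotent `e`
commuting with the preimage of `K` to be `0` or `1` (`eq_zero_or_eq_one_of_idempotent`). Averaged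
eigenprojections then give Schur's lemma, hence nonsingularity, `K = C_G(K)`, and faithfulness.

Conjugation preserves commutators, so the Weyl group lands in `Sp(K)`. Conversely, `Sp(K)` is
generated by transvections: they move a pair `a`, `b` with `⟨a, b⟩` of maximal order to any
prescribed isometric image, and induction applies to the orthogonal complement
(`isometryGroup_le_aux`). Each transvection `s_b` is conjugation by a Gauss sum in a lift of `b`
(`transvection_mem_range_weylAction`).

Finally, a lift of `b⁻¹` is a root vector for `⟨b, ·⟩ ≠ 1`, so every nontrivial character is a root.
-/

namespace SymplecticAbelian

/-! ### Orders of values of a pairing -/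

section Pairings

variable {H : Type*} [Group H]

theorem IsAlternating.swap {B : H →* H →* ℂˣ} (hB : IsAlternating B) (a b : H) :
    B a b = (B b a)⁻¹ := by
  have h := hB (a * b)
  simp only [map_mul, MonoidHom.mul_apply, hB a, hB b, one_mul, mul_one] at h
  exact eq_inv_of_mul_eq_one_right h

theorem orderOf_pairing_dvd (B : H →* H →* ℂˣ) (c x : H) : orderOf (B c x) ∣ orderOf c := by
  rw [orderOf_dvd_iff_pow_eq_one, ← MonoidHom.pow_apply, ← map_pow, pow_orderOf_eq_one, map_one,
    MonoidHom.one_apply]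

theorem pairing_pow_exponent (B : H →* H →* ℂˣ) (c x : H) : B c x ^ Monoid.exponent H = 1 := by
  rw [← map_pow, Monoid.pow_exponent_eq_one, map_one]

theorem orderOf_eq_exponent_of_pairing (B : H →* H →* ℂˣ) {c x : H}
    (h : orderOf (B c x) = Monoid.exponent H) : orderOf c = Monoid.exponent H :=
  Nat.dvd_antisymm (Monoid.order_dvd_exponent c) (h ▸ orderOf_pairing_dvd B c x)

/-- Every element pairs with some element to a root of unity of the same order. -/
theorem exists_orderOf_pairing_eq [Finite H] (B : H →* H →* ℂˣ) (hns : IsNonsingular B) (a : H) :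
    ∃ b, orderOf (B a b) = orderOf a := by
  have : Finite (B a).range := Finite.of_surjective _ (B a).rangeRestrict_surjective
  -- A finite subgroup of `ℂˣ` is cyclic; take `b` mapping to a generator of the image of `⟨a, ·⟩`.
  obtain ⟨⟨_, b, rfl⟩, hg⟩ := IsCyclic.exists_generator (α := (B a).range)
  refine ⟨b, Nat.dvd_antisymm (orderOf_pairing_dvd B a b) ?_⟩
  rw [orderOf_dvd_iff_pow_eq_one]
  apply hns
  intro c
  obtain ⟨k, hk⟩ := hg ⟨B a c, c, rfl⟩
  have hk' : B a b ^ k = B a c := congrArg Subtype.val hk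
  rw [map_pow, MonoidHom.pow_apply, ← hk', ← zpow_natCast, ← zpow_mul, mul_comm, zpow_mul,
    zpow_natCast, pow_orderOf_eq_one, one_zpow]

/-- Two characters which take values of order `M` separately do so at a common element. -/
theorem exists_common_orderOf_eq {A : Type*} [CommGroup A] {f g : H →* A} {M : ℕ} (hM : 0 < M)
    (hf : ∀ x, f x ^ M = 1) (hg : ∀ x, g x ^ M = 1) {x y : H} (hx : orderOf (f x) = M)
    (hy : orderOf (g y) = M) : ∃ z, orderOf (f z) = M ∧ orderOf (g z) = M := by
  classical
  -- Order `M` is tested prime by prime: `w ^ (M / p) ≠ 1`. The product `x ^ ∏ S * y ^ ∏ T` drops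
  -- `y` at `p` if `x` serves both `f` and `g`, drops `x` if only `y` does, and keeps both
  -- otherwise; in that last case `x` alone contributes to `f` and `y` alone to `g`.
  set S := M.primeFactors.filter fun p => g x ^ (M / p) = 1 ∧ f y ^ (M / p) ≠ 1 with hS
  set T := M.primeFactors.filter fun p => g x ^ (M / p) ≠ 1 with hT
  have hdvd : ∀ (R : Finset ℕ), R ⊆ M.primeFactors → ∀ p, p.Prime → p ∣ ∏ q ∈ R, q → p ∈ R := by
    intro R hR p hp h
    obtain ⟨q, hq, hpq⟩ := (hp.prime.dvd_finsetProd_iff _).1 h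
    rwa [(Nat.prime_dvd_prime_iff_eq hp (Nat.prime_of_mem_primeFactors (hR hq))).1 hpq]
  have hpow : ∀ (w : A) (p k : ℕ), p.Prime → p ∣ M → w ^ M = 1 → w ^ (M / p) ≠ 1 → ¬ p ∣ k →
      (w ^ k) ^ (M / p) ≠ 1 := by
    intro w p k hp hpM hw h1 hk h2
    have h3 : (w ^ (M / p)) ^ p = 1 := by rw [← pow_mul, Nat.div_mul_cancel hpM, hw]
    have : Fact p.Prime := ⟨hp⟩
    rw [← pow_mul, mul_comm, pow_mul, ← orderOf_dvd_iff_pow_eq_one,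
      orderOf_eq_prime h3 h1] at h2
    exact hk h2
  have hpow1 : ∀ (w : A) (p k : ℕ), p ∣ M → w ^ M = 1 → p ∣ k → (w ^ k) ^ (M / p) = 1 := by
    rintro w p _ hpM hw ⟨k, rfl⟩
    rw [← pow_mul, mul_right_comm, Nat.mul_div_cancel' hpM, pow_mul, hw, one_pow]
  have hpow2 : ∀ (w : A) (p k : ℕ), w ^ (M / p) = 1 → (w ^ k) ^ (M / p) = 1 := by
    intro w p k hw
    rw [← pow_mul, mul_comm, pow_mul, hw, one_pow]
  have hne : ∀ (w : A) (p : ℕ), p.Prime → p ∣ M → orderOf w = M → w ^ (M / p) ≠ 1 := by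
    intro w p hp hpM hw
    exact pow_ne_one_of_lt_orderOf (Nat.div_pos (Nat.le_of_dvd hM hpM) hp.pos).ne'
      (hw.symm ▸ Nat.div_lt_self hM hp.one_lt)
  refine ⟨x ^ (∏ q ∈ S, q) * y ^ (∏ q ∈ T, q), ?_, ?_⟩ <;>
    refine orderOf_eq_of_pow_and_pow_div_prime hM (by first | exact hf _ | exact hg _) ?_ <;>
    intro p hp hpM <;> rw [map_mul, map_pow, map_pow, mul_pow] <;>
    have hmem : p ∈ M.primeFactors := Nat.mem_primeFactors.2 ⟨hp, hpM, hM.ne'⟩ <;>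
    have hSd := hdvd S (Finset.filter_subset _ _) p hp <;>
    have hTd := hdvd T (Finset.filter_subset _ _) p hp <;>
    by_cases h1 : g x ^ (M / p) = 1
  · have hTn : ¬ p ∣ ∏ q ∈ T, q := fun h => (Finset.mem_filter.1 (hTd h)).2 h1
    by_cases h2 : f y ^ (M / p) = 1
    · have hSn : ¬ p ∣ ∏ q ∈ S, q := fun h => (Finset.mem_filter.1 (hSd h)).2.2 h2
      rw [hpow2 _ _ _ h2, mul_one]
      exact hpow _ _ _ hp hpM (hf _) (hne _ _ hp hpM hx) hSn
    · have hSy : p ∣ ∏ q ∈ S, q :=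
        Finset.dvd_prod_of_mem _ (Finset.mem_filter.2 ⟨hmem, h1, h2⟩)
      rw [hpow1 _ _ _ hpM (hf _) hSy, one_mul]
      exact hpow _ _ _ hp hpM (hf _) h2 hTn
  · have hTy : p ∣ ∏ q ∈ T, q := Finset.dvd_prod_of_mem _ (Finset.mem_filter.2 ⟨hmem, h1⟩)
    have hSn : ¬ p ∣ ∏ q ∈ S, q := fun h => h1 (Finset.mem_filter.1 (hSd h)).2.1
    rw [hpow1 _ _ _ hpM (hf _) hTy, mul_one]
    exact hpow _ _ _ hp hpM (hf _) (hne _ _ hp hpM hx) hSn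
  · have hTn : ¬ p ∣ ∏ q ∈ T, q := fun h => (Finset.mem_filter.1 (hTd h)).2 h1
    rw [hpow2 _ _ _ h1, one_mul]
    exact hpow _ _ _ hp hpM (hg _) (hne _ _ hp hpM hy) hTn
  · have hTy : p ∣ ∏ q ∈ T, q := Finset.dvd_prod_of_mem _ (Finset.mem_filter.2 ⟨hmem, h1⟩)
    have hSn : ¬ p ∣ ∏ q ∈ S, q := fun h => h1 (Finset.mem_filter.1 (hSd h)).2.1
    rw [hpow1 _ _ _ hpM (hg _) hTy, mul_one]
    exact hpow _ _ _ hp hpM (hg _) h1 hSn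

end Pairings

/-! ### Transvections and their transitivity -/

section Generation

variable {H : Type*} [Group H] [IsMulCommutative H] [Finite H]

theorem transvection_apply_of_omega_zpow (B : H →* H →* ℂˣ) (hB : IsAlternating B) {b a : H}
    {j : ℤ} (h : omega (orderOf b) ^ j = B b a) : transvection B hB b a = a * (b ^ j)⁻¹ := by
  change a * (rootSMul (B b a) b)⁻¹ = _
  rw [← h, rootSMul_omega_zpow]

/-- With `⟨b, a⟩ = ω ^ i` and `⟨b, c⟩ = ω ^ j`, the two cross terms are `ω ^ (i * j)` and its
inverse. -/
theorem transvection_mem_isometryGroup (B : H →* H →* ℂˣ) (hB : IsAlternating B) (b : H) :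
    transvection B hB b ∈ isometryGroup B := by
  intro a c
  obtain ⟨i, hi⟩ := exists_omega_zpow B b a
  obtain ⟨j, hj⟩ := exists_omega_zpow B b c
  rw [transvection_apply_of_omega_zpow B hB hi, transvection_apply_of_omega_zpow B hB hj]
  simp only [map_mul, map_inv, map_zpow, MonoidHom.mul_apply, MonoidHom.inv_apply,
    MonoidHom.zpow_apply, hB b, hB.swap a b, ← hi, ← hj, one_zpow, inv_one, mul_one]
  rw [← zpow_neg, ← zpow_neg, ← zpow_neg, ← zpow_mul, ← zpow_mul, mul_assoc, ← zpow_add]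
  simp [mul_comm]

theorem transvection_one (B : H →* H →* ℂˣ) (hB : IsAlternating B) :
    transvection B hB 1 = 1 := by
  ext a
  have h : omega (orderOf (1 : H)) ^ (0 : ℤ) = B 1 a := by simp
  rw [transvection_apply_of_omega_zpow B hB h]
  simp

/-- The subgroup of `Aut(H)` generated by all transvections. -/
noncomputable def transvectionGroup (B : H →* H →* ℂˣ) (hB : IsAlternating B) :
    Subgroup (MulAut H) :=
  Subgroup.closure (Set.range (transvection B hB))

theorem transvection_mem (B : H →* H →* ℂˣ) (hB : IsAlternating B) (b : H) :
    transvection B hB b ∈ transvectionGroup B hB :=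
  Subgroup.subset_closure ⟨b, rfl⟩

theorem transvectionGroup_le (B : H →* H →* ℂˣ) (hB : IsAlternating B) :
    transvectionGroup B hB ≤ isometryGroup B := by
  rw [transvectionGroup, Subgroup.closure_le]
  rintro _ ⟨b, rfl⟩
  exact transvection_mem_isometryGroup B hB b

/-- Since `⟨b, b⟩ = 1`, the transvection fixes `b`, so iterating it adds up the exponents. -/
theorem transvection_zpow_apply (B : H →* H →* ℂˣ) (hB : IsAlternating B) {b a : H}
    {j : ℤ} (h : omega (orderOf b) ^ j = B b a) (k : ℤ) :
    (transvection B hB b ^ k) a = a * b ^ (-(k * j)) := by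
  have hfix : transvection B hB b b = b := by
    rw [transvection_apply_of_omega_zpow B hB (j := 0) (by simp [hB b])]; simp
  have hs : transvection B hB b a = a * b ^ (-j) := by
    rw [transvection_apply_of_omega_zpow B hB h, zpow_neg]
  have hs' : (transvection B hB b)⁻¹ a = a * b ^ j := by
    rw [MulAut.inv_apply, MulEquiv.symm_apply_eq, map_mul, hs, map_zpow, hfix, mul_assoc,
      ← zpow_add]
    simp
  have hfix' : (transvection B hB b)⁻¹ b = b := by
    rw [MulAut.inv_apply, MulEquiv.symm_apply_eq, hfix]
  induction k with
  | zero => simp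
  | succ k ih =>
    rw [zpow_add_one, (Commute.refl (transvection B hB b)).zpow_left k |>.eq, MulAut.mul_apply,
      ih, map_mul, map_zpow, hs, hfix, mul_assoc, ← zpow_add]
    congr 2; ring
  | pred k ih =>
    rw [zpow_sub_one,
      ((Commute.refl (transvection B hB b)).zpow_left _).inv_right.eq, MulAut.mul_apply,
      ih, map_mul, map_zpow, hs', hfix', mul_assoc, ← zpow_add]
    congr 2; ring

/-- If `⟨c, x⟩` has the same order as `c`, then a power of the transvection `s_c` maps `x` to
`x * c`; it fixes everything orthogonal to `c`. -/
theorem exists_mem_transvectionGroup_apply_eq_mul (B : H →* H →* ℂˣ) (hB : IsAlternating B)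
    {c x : H} (h : orderOf (B c x) = orderOf c) :
    ∃ ψ ∈ transvectionGroup B hB, ψ x = x * c ∧ ∀ y, B c y = 1 → ψ y = y := by
  obtain ⟨j, hj⟩ := exists_omega_zpow B c x
  have hω := omega_isPrimitiveRoot (orderOf_pos c).ne'
  -- `ω ^ j` is still a primitive root, so `j` is invertible modulo the order of `c`, with inverse
  -- `u`.
  obtain ⟨u, hu⟩ : ∃ u : ℤ, c ^ (j * u) = c := by
    rw [← hj] at h
    have hp := IsPrimitiveRoot.orderOf (omega (orderOf c) ^ j)
    rw [h] at hp
    have : NeZero (orderOf c) := ⟨(orderOf_pos c).ne'⟩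
    have hmem : omega (orderOf c) ∈ Subgroup.zpowers (omega (orderOf c) ^ j) := by
      rw [hp.zpowers_eq]
      exact hω.pow_eq_one
    obtain ⟨u, hu⟩ := hmem
    refine ⟨u, ?_⟩
    have h1 : omega (orderOf c) ^ (j * u) = omega (orderOf c) ^ (1 : ℤ) := by
      rw [zpow_mul, zpow_one]; exact hu
    rw [zpow_eq_zpow_iff_modEq, ← hω.eq_orderOf, ← zpow_eq_zpow_iff_modEq, zpow_one] at h1
    exact h1
  refine ⟨transvection B hB c ^ (-u), Subgroup.zpow_mem _ (transvection_mem B hB c) _, ?_, ?_⟩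
  · rw [transvection_zpow_apply B hB hj]
    have : -(-u * j) = j * u := by ring
    rw [this, hu]
  · intro y hy
    rw [transvection_zpow_apply B hB (j := 0) (by simp [hy])]
    simp

/-- Take `c = a⁻¹ * a'`: then `⟨c, a⟩ = ⟨a, a'⟩⁻¹` has maximal order, and `c` is orthogonal to every
`y` that pairs equally with `a` and `a'`. -/
theorem exists_map_eq_of_orderOf_pairing (B : H →* H →* ℂˣ) (hB : IsAlternating B) {a a' : H}
    (h : orderOf (B a a') = Monoid.exponent H) :
    ∃ ψ ∈ transvectionGroup B hB, ψ a = a' ∧ ∀ y, B a y = B a' y → ψ y = y := by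
  have h1 : B (a⁻¹ * a') a = (B a a')⁻¹ := by
    rw [map_mul, MonoidHom.mul_apply, map_inv, MonoidHom.inv_apply, hB a, inv_one, one_mul,
      hB.swap]
  have h2 : orderOf (B (a⁻¹ * a') a) = Monoid.exponent H := by rw [h1, orderOf_inv, h]
  obtain ⟨ψ, hψ, hψa, hψy⟩ := exists_mem_transvectionGroup_apply_eq_mul B hB
    (h2.trans (orderOf_eq_exponent_of_pairing B h2).symm)
  refine ⟨ψ, hψ, by rw [hψa, mul_inv_cancel_left], fun y hy => hψy y ?_⟩
  rw [map_mul, MonoidHom.mul_apply, map_inv, MonoidHom.inv_apply, hy, inv_mul_cancel]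

/-- The transvections act transitively on the elements of maximal order. -/
theorem exists_map_eq_of_orderOf_eq_exponent (B : H →* H →* ℂˣ) (hB : IsAlternating B)
    (hns : IsNonsingular B) {a a' : H} (ha : orderOf a = Monoid.exponent H)
    (ha' : orderOf a' = Monoid.exponent H) : ∃ ψ ∈ transvectionGroup B hB, ψ a = a' := by
  obtain ⟨x, hx⟩ := exists_orderOf_pairing_eq B hns a
  obtain ⟨y, hy⟩ := exists_orderOf_pairing_eq B hns a'
  -- `⟨a, a'⟩` itself may have small order, so the route is `a → z → a'`.
  obtain ⟨z, hz, hz'⟩ := exists_common_orderOf_eq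
    (Nat.pos_of_ne_zero Monoid.exponent_ne_zero_of_finite) (pairing_pow_exponent B a)
    (pairing_pow_exponent B a') (hx.trans ha) (hy.trans ha')
  obtain ⟨ψ, hψ, h1, -⟩ := exists_map_eq_of_orderOf_pairing B hB hz
  rw [hB.swap, orderOf_inv] at hz'
  obtain ⟨ψ', hψ', h2, -⟩ := exists_map_eq_of_orderOf_pairing B hB hz'
  exact ⟨ψ' * ψ, mul_mem hψ' hψ, by rw [MulAut.mul_apply, h1, h2]⟩

/-- The stabilizer of `a` in the transvection group acts transitively on the elements whose
pairing with `a` is a given root of unity of maximal order. -/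
theorem exists_map_eq_fixing (B : H →* H →* ℂˣ) (hB : IsAlternating B) {a b b' : H}
    (hab : orderOf (B a b) = Monoid.exponent H) (hb : B a b' = B a b) :
    ∃ ψ ∈ transvectionGroup B hB, ψ a = a ∧ ψ b = b' := by
  obtain ⟨ψ, hψ, h1, h2⟩ := exists_mem_transvectionGroup_apply_eq_mul B hB
    (hab.trans (orderOf_eq_exponent_of_pairing B hab).symm)
  have hψa : ψ a = a := h2 a (hB a)
  have hpow : ∀ k : ℕ, (ψ ^ k) a = a ∧ (ψ ^ k) b = b * a ^ k := by
    intro k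
    induction k with
    | zero => simp
    | succ k ih =>
      rw [pow_succ', MulAut.mul_apply, MulAut.mul_apply, ih.1, ih.2, map_mul, map_pow, hψa, h1,
        mul_assoc, ← pow_succ']
      exact ⟨rfl, rfl⟩
  have hprim : IsPrimitiveRoot (B a b) (Monoid.exponent H) := hab ▸ IsPrimitiveRoot.orderOf _
  have : NeZero (Monoid.exponent H) := ⟨Monoid.exponent_ne_zero_of_finite⟩
  -- `k` is chosen so that `⟨b * a ^ k, b'⟩ = ⟨a, b⟩` has maximal order. Then `b * a ^ k` can be
  -- moved to `b'`; this move fixes `a`, which pairs equally with both.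
  obtain ⟨k, hk⟩ : ∃ k : ℕ, B a b ^ k = B a b * (B b b')⁻¹ := by
    have h3 : B a b * (B b b')⁻¹ ∈ Subgroup.zpowers (B a b) := by
      rw [hprim.zpowers_eq]
      change _ ^ Monoid.exponent H = 1
      rw [mul_pow, inv_pow, pairing_pow_exponent, pairing_pow_exponent, inv_one, one_mul]
    have hfin : IsOfFinOrder (B a b) := isOfFinOrder_iff_pow_eq_one.2
      ⟨_, Nat.pos_of_ne_zero Monoid.exponent_ne_zero_of_finite, pairing_pow_exponent B a b⟩
    exact hfin.mem_powers_iff_mem_zpowers.2 h3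
  have h4 : B (b * a ^ k) b' = B a b := by
    rw [map_mul, MonoidHom.mul_apply, map_pow, MonoidHom.pow_apply, hb, hk, mul_comm (B a b),
      mul_inv_cancel_left]
  obtain ⟨θ, hθ, h5, h6⟩ := exists_map_eq_of_orderOf_pairing B hB (h4 ▸ hab)
  refine ⟨θ * ψ ^ k, mul_mem hθ (pow_mem hψ k), ?_, ?_⟩
  · rw [MulAut.mul_apply, (hpow k).1]
    apply h6
    rw [map_mul, MonoidHom.mul_apply, map_pow, MonoidHom.pow_apply, hB a, one_pow, mul_one,
      hB.swap, hB.swap b', hb]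
  · rw [MulAut.mul_apply, (hpow k).2, h5]

end Generation

/-! ### Generation of the isometry group by transvections -/

section Induction

universe u

/-- The pairing restricted to a subgroup. -/
def restrictPairing {H : Type*} [Group H] (B : H →* H →* ℂˣ) (Q : Subgroup H) : Q →* Q →* ℂˣ :=
  MonoidHom.mk' (fun a => (B a).comp Q.subtype) fun a b => by ext; simp

/-- Automorphisms of a subgroup `Q` in the transvection group extend to automorphisms of the whole
group in the transvection group which fix the orthogonal complement of `Q`. -/
theorem exists_extension {H : Type*} [Group H] [IsMulCommutative H] [Finite H]
    (B : H →* H →* ℂˣ) (hB : IsAlternating B) (Q : Subgroup H)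
    (hB' : IsAlternating (restrictPairing B Q)) {ψ : MulAut Q}
    (hψ : ψ ∈ transvectionGroup (restrictPairing B Q) hB') :
    ∃ θ ∈ transvectionGroup B hB, (∀ q : Q, θ q = ψ q) ∧ ∀ y, (∀ q ∈ Q, B q y = 1) → θ y = y := by
  refine Subgroup.closure_induction (p := fun ψ _ => ∃ θ ∈ transvectionGroup B hB,
    (∀ q : Q, θ q = ψ q) ∧ ∀ y, (∀ q ∈ Q, B q y = 1) → θ y = y) ?_ ?_ ?_ ?_ hψ
  · rintro _ ⟨b, rfl⟩
    refine ⟨transvection B hB b, transvection_mem B hB b, fun q => ?_, fun y hy => ?_⟩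
    · obtain ⟨j, hj⟩ := exists_omega_zpow (restrictPairing B Q) b q
      have hj' : omega (orderOf (b : H)) ^ j = B b q := by
        rw [Subgroup.orderOf_coe]; exact hj
      rw [transvection_apply_of_omega_zpow _ hB' hj, transvection_apply_of_omega_zpow _ hB hj']
      rfl
    · rw [transvection_apply_of_omega_zpow B hB (j := 0) (by simp [hy b.1 b.2])]
      simp
  · exact ⟨1, one_mem _, fun q => rfl, fun y _ => rfl⟩
  · rintro ψ₁ ψ₂ _ _ ⟨θ₁, h1, h2, h3⟩ ⟨θ₂, k1, k2, k3⟩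
    refine ⟨θ₁ * θ₂, mul_mem h1 k1, fun q => ?_, fun y hy => ?_⟩
    · rw [MulAut.mul_apply, k2, h2]; rfl
    · rw [MulAut.mul_apply, k3 y hy, h3 y hy]
  · rintro ψ₁ _ ⟨θ₁, h1, h2, h3⟩
    refine ⟨θ₁⁻¹, inv_mem h1, fun q => ?_, fun y hy => ?_⟩
    · rw [MulAut.inv_apply, MulEquiv.symm_apply_eq, h2, MulAut.apply_inv_self]
    · rw [MulAut.inv_apply, MulEquiv.symm_apply_eq, h3 y hy]

/-- Strong induction on the order. After multiplication by transvections the isometry fixes `a` and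
`b` with `⟨a, b⟩` of maximal order, so it preserves their orthogonal complement `Q`; the induction
hypothesis for `Q` extends to `H` by the identity on `a` and `b`. -/
theorem isometryGroup_le_aux (N : ℕ) : ∀ (H : Type u) [Group H] [IsMulCommutative H] [Finite H]
    (B : H →* H →* ℂˣ) (hB : IsAlternating B) (_ : IsNonsingular B), Nat.card H = N →
    isometryGroup B ≤ transvectionGroup B hB := by
  induction N using Nat.strong_induction_on with
  | _ N ih =>
  intro H _ _ _ B hB hns hN φ hφ
  let _ : CommGroup H := { (inferInstance : Group H) with mul_comm := mul_comm' }
  rcases subsingleton_or_nontrivial H with hsub | hnt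
  · have : φ = 1 := MulEquiv.ext fun x => Subsingleton.elim _ _
    rw [this]; exact one_mem _
  obtain ⟨a, ha⟩ := Monoid.exists_orderOf_eq_exponent (Monoid.ExponentExists.of_finite (G := H))
  obtain ⟨b, hb⟩ := exists_orderOf_pairing_eq B hns a
  rw [ha] at hb
  obtain ⟨ψ₁, hψ₁, h1⟩ := exists_map_eq_of_orderOf_eq_exponent B hB hns (a := φ a) (a' := a)
    (by rw [← ha]; exact MulEquiv.orderOf_eq φ a) ha
  have hφ₁ : ψ₁ * φ ∈ isometryGroup B := mul_mem (transvectionGroup_le B hB hψ₁) hφ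
  have hab : B a ((ψ₁ * φ) b) = B a b := by
    have := hφ₁ a b
    rwa [MulAut.mul_apply, h1] at this
  obtain ⟨ψ₂, hψ₂, h2, h3⟩ := exists_map_eq_fixing B hB (hab ▸ hb) hab.symm
  set χ := ψ₂ * (ψ₁ * φ) with hχ
  have hχa : χ a = a := by rw [hχ, MulAut.mul_apply, MulAut.mul_apply, h1, h2]
  have hχb : χ b = b := by rw [hχ, MulAut.mul_apply, h3]
  have hχi : χ ∈ isometryGroup B := mul_mem (transvectionGroup_le B hB hψ₂) hφ₁
  suffices χ ∈ transvectionGroup B hB by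
    have h4 : φ = ψ₁⁻¹ * (ψ₂⁻¹ * χ) := by simp [hχ]
    rw [h4]
    exact mul_mem (inv_mem hψ₁) (mul_mem (inv_mem hψ₂) this)
  have hprim : IsPrimitiveRoot (B a b) (Monoid.exponent H) := hb ▸ IsPrimitiveRoot.orderOf _
  have : NeZero (Monoid.exponent H) := ⟨Monoid.exponent_ne_zero_of_finite⟩
  set Q : Subgroup H := (B a).ker ⊓ (B b).ker with hQ
  have hQmem : ∀ x, x ∈ Q ↔ B a x = 1 ∧ B b x = 1 := fun x => Iff.rfl
  have hlog : ∀ c h, ∃ j : ℤ, B a b ^ j = B c h := by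
    intro c h
    have h3 : B c h ∈ Subgroup.zpowers (B a b) := by
      rw [hprim.zpowers_eq]
      exact pairing_pow_exponent B c h
    exact h3
  -- Orthogonal projection: every value of the pairing is a power of `⟨a, b⟩`, so powers of `a` and
  -- `b` can correct `h` into `Q`.
  have hdec : ∀ h : H, ∃ q ∈ Q, ∃ i j : ℤ, h = q * a ^ i * b ^ j := by
    intro h
    obtain ⟨j, hj⟩ := hlog a h
    obtain ⟨i, hi⟩ := hlog b h
    refine ⟨h * b ^ (-j) * a ^ i, ?_, -i, j, ?_⟩
    · rw [hQmem]
      simp only [map_mul, map_zpow, hB a, hB b, hB.swap b a, ← hi, ← hj]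
      constructor
      · simp
      · simp
    · simp
  have hBQ : IsAlternating (restrictPairing B Q) := fun q => hB q
  have hnsQ : IsNonsingular (restrictPairing B Q) := by
    intro q hq
    apply Subtype.ext
    apply hns
    intro h
    obtain ⟨q', hq', i, j, rfl⟩ := hdec h
    have h5 := (hQmem q).1 q.2
    have h6 : B q q' = 1 := hq ⟨q', hq'⟩
    rw [map_mul, map_mul, map_zpow, map_zpow, h6, hB.swap q a, hB.swap q b, h5.1, h5.2]
    simp
  have hM : Monoid.exponent H ≠ 1 := by
    rw [Ne, Monoid.exp_eq_one_iff]
    exact not_subsingleton H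
  -- `b ∉ Q`, since the order of `⟨a, b⟩` is the exponent, which is not `1`.
  have hcard : Nat.card Q < N := by
    rw [← hN]
    refine lt_of_le_of_ne (Subgroup.card_le_card_group Q) fun h => hM ?_
    have htop := Subgroup.eq_top_of_card_eq Q h
    have : b ∈ Q := htop ▸ Subgroup.mem_top b
    rw [← hb, ((hQmem b).1 this).1, orderOf_one]
  have hχQ : ∀ x, x ∈ Q → χ x ∈ Q := by
    intro x hx
    rw [hQmem] at hx ⊢
    have e1 := hχi a x
    have e2 := hχi b x
    rw [hχa] at e1
    rw [hχb] at e2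
    exact ⟨e1.trans hx.1, e2.trans hx.2⟩
  let χQ : MulAut Q := MulEquiv.ofBijective
    ((χ.toMonoidHom.comp Q.subtype).codRestrict Q fun x => hχQ x x.2) <| by
      apply Finite.injective_iff_bijective.1
      intro x y hxy
      exact Subtype.ext (χ.injective (congrArg Subtype.val hxy))
  have hχQi : χQ ∈ isometryGroup (restrictPairing B Q) := fun x y => hχi x y
  obtain ⟨θ, hθ, hθQ, hθfix⟩ :=
    exists_extension B hB Q hBQ (ih _ hcard Q (restrictPairing B Q) hBQ hnsQ rfl hχQi)
  have hθa : θ a = a := hθfix a fun q hq => by rw [hB.swap, hq.1, inv_one]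
  have hθb : θ b = b := hθfix b fun q hq => by rw [hB.swap, ((hQmem q).1 hq).2, inv_one]
  have : χ = θ := by
    ext h
    obtain ⟨q, hq, i, j, rfl⟩ := hdec h
    have h7 : θ q = χ q := hθQ ⟨q, hq⟩
    rw [map_mul, map_mul, map_mul, map_mul, map_zpow, map_zpow, map_zpow, map_zpow, hχa, hχb,
      hθa, hθb, h7]
  rw [this]
  exact hθ

/-- The isometry group of a nonsingular alternating pairing on a finite abelian group is generated
by transvections. -/
theorem isometryGroup_eq_transvectionGroup {H : Type*} [Group H] [IsMulCommutative H] [Finite H]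
    (B : H →* H →* ℂˣ) (hB : IsAlternating B) (hns : IsNonsingular B) :
    isometryGroup B = transvectionGroup B hB :=
  le_antisymm (isometryGroup_le_aux _ H B hB hns rfl) (transvectionGroup_le B hB)

end Induction

end SymplecticAbelian

namespace PGLWeyl

open Matrix

/-! ### Lifting from `PGL` to `GL` -/

section Lifts

variable {n : ℕ}

theorem coe_scalar_eq_smul_one (u : ℂˣ) :
    ((Matrix.GeneralLinearGroup.scalar (Fin n) u : GL (Fin n) ℂ) : Matrix (Fin n) (Fin n) ℂ) =
      (u : ℂ) • (1 : Matrix (Fin n) (Fin n) ℂ) := by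
  rw [Matrix.GeneralLinearGroup.coe_scalar, Matrix.scalar_apply, Matrix.smul_one_eq_diagonal]

theorem proj_eq_proj_iff {g h : GL (Fin n) ℂ} :
    proj g = proj h ↔ ∃ u : ℂˣ, h.1 = (u : ℂ) • g.1 := by
  rw [Matrix.ProjGenLinGroup.mk_eq_mk_iff]
  refine exists_congr fun u => ?_
  rw [← Units.val_inj, Units.val_mul, coe_scalar_eq_smul_one, Matrix.mul_smul, Matrix.mul_one,
    eq_comm]

theorem conj_eq_conj_of_proj_eq {g h : GL (Fin n) ℂ} (H : proj g = proj h)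
    (X : Matrix (Fin n) (Fin n) ℂ) : g.1 * X * (g⁻¹).1 = h.1 * X * (h⁻¹).1 := by
  obtain ⟨u, rfl⟩ := Matrix.ProjGenLinGroup.mk_eq_mk_iff.1 H
  rw [_root_.mul_inv_rev, ← map_inv, ← scalar_mul_comm u g, Units.val_mul, Units.val_mul,
    coe_scalar_eq_smul_one, coe_scalar_eq_smul_one]
  simp [Matrix.mul_assoc, smul_smul]

theorem mul_eq_pairing_smul_mul {K : Subgroup (PGL n)} [IsMulCommutative K] [NeZero n] {σ τ : K}
    {g h : GL (Fin n) ℂ} (hg : proj g = σ) (hh : proj h = τ) :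
    g.1 * h.1 = (commutatorPairing K σ τ : ℂ) • (h.1 * g.1) := by
  have h1 := commutatorScalar_spec K σ τ hg hh
  rw [mul_inv_eq_iff_eq_mul, mul_inv_eq_iff_eq_mul] at h1
  have h2 := congrArg Units.val h1
  rwa [Units.val_mul, Units.val_mul, Units.val_mul, coe_scalar_eq_smul_one, Matrix.smul_mul,
    Matrix.one_mul, Matrix.smul_mul] at h2

end Lifts

/-! ### Finite subsets are Zariski closed -/

section Closed

variable {n : ℕ}

theorem isZariskiClosed_empty : IsZariskiClosed (∅ : Set (PGL n)) :=
  ⟨{1}, fun g => by simp⟩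

theorem IsZariskiClosed.union {S T : Set (PGL n)} (hS : IsZariskiClosed S)
    (hT : IsZariskiClosed T) : IsZariskiClosed (S ∪ T) := by
  obtain ⟨P, hP⟩ := hS
  obtain ⟨Q, hQ⟩ := hT
  refine ⟨{f | ∃ p ∈ P, ∃ q ∈ Q, f = p * q}, fun g => ?_⟩
  rw [Set.mem_union, hP, hQ]
  constructor
  · rintro (h | h) _ ⟨p, hp, q, hq, rfl⟩
    · rw [map_mul, h p hp, zero_mul]
    · rw [map_mul, h q hq, mul_zero]
  · intro h
    by_contra! hc
    obtain ⟨⟨p, hp, hp0⟩, ⟨q, hq, hq0⟩⟩ := hc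
    have := h _ ⟨p, hp, q, hq, rfl⟩
    rw [map_mul] at this
    exact mul_ne_zero hp0 hq0 this

theorem isZariskiClosed_singleton [NeZero n] (x : PGL n) : IsZariskiClosed ({x} : Set (PGL n)) := by
  obtain ⟨g, rfl⟩ := Matrix.ProjGenLinGroup.mk_surjective x
  -- These are the `2 × 2` minors expressing that the matrix is proportional to `g`.
  refine ⟨Set.range fun a : (Fin n × Fin n) × (Fin n × Fin n) =>
    MvPolynomial.X a.1 * MvPolynomial.C (g.1 a.2.1 a.2.2) -
      MvPolynomial.X a.2 * MvPolynomial.C (g.1 a.1.1 a.1.2), fun h => ?_⟩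
  rw [Set.mem_singleton_iff, eq_comm, proj_eq_proj_iff]
  constructor
  · rintro ⟨u, hu⟩ _ ⟨a, rfl⟩
    simp only [map_sub, map_mul, MvPolynomial.eval_X, MvPolynomial.eval_C, hu, Matrix.smul_apply,
      smul_eq_mul]
    ring
  · intro H
    have hg : g.1 ≠ 0 := g.ne_zero
    have hh : h.1 ≠ 0 := h.ne_zero
    obtain ⟨k, l, hkl⟩ : ∃ k l, g.1 k l ≠ 0 := by
      by_contra! hc
      exact hg (Matrix.ext hc)
    have H' : ∀ i j, h.1 i j = h.1 k l / g.1 k l * g.1 i j := by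
      intro i j
      have := H _ ⟨((i, j), (k, l)), rfl⟩
      simp only [map_sub, map_mul, MvPolynomial.eval_X, MvPolynomial.eval_C] at this
      field_simp
      linear_combination this
    have hne : h.1 k l / g.1 k l ≠ 0 := by
      intro h0
      exact hh (Matrix.ext fun i j => by rw [H' i j, h0, zero_mul, Matrix.zero_apply])
    exact ⟨Units.mk0 _ hne, Matrix.ext fun i j => H' i j⟩

theorem isZariskiClosed_of_finite [NeZero n] {S : Set (PGL n)} (hS : S.Finite) :
    IsZariskiClosed S := by
  induction S, hS using Set.Finite.induction_on with
  | empty => exact isZariskiClosed_empty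
  | insert _ _ ih =>
    rw [Set.insert_eq]
    exact (isZariskiClosed_singleton _).union ih

end Closed

theorem weylAction_mk {n : ℕ} {K : Subgroup (PGL n)} [IsMulCommutative K]
    (x : Subgroup.normalizer (K : Set (PGL n))) (σ : K) :
    (weylAction K (QuotientGroup.mk x) σ : PGL n) = x * σ * (x : PGL n)⁻¹ := rfl

/-- The commutator of two conjugates is the conjugate of a scalar commutator, hence the same scalar.
-/
theorem weylAction_range_le {n : ℕ} [NeZero n] {K : Subgroup (PGL n)} [IsMulCommutative K] :
    (weylAction K).range ≤ SymplecticAbelian.isometryGroup (commutatorPairing K) := by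
  rintro _ ⟨q, rfl⟩ σ τ
  induction q using QuotientGroup.induction_on with
  | H x =>
  obtain ⟨y, hy⟩ := Matrix.ProjGenLinGroup.mk_surjective (x : PGL n)
  obtain ⟨g, hg⟩ := Matrix.ProjGenLinGroup.mk_surjective (σ : PGL n)
  obtain ⟨h, hh⟩ := Matrix.ProjGenLinGroup.mk_surjective (τ : PGL n)
  have hg' : proj (y * g * y⁻¹) = (weylAction K (QuotientGroup.mk x) σ : PGL n) := by
    rw [weylAction_mk, map_mul, map_mul, map_inv, hy, hg]
  have hh' : proj (y * h * y⁻¹) = (weylAction K (QuotientGroup.mk x) τ : PGL n) := by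
    rw [weylAction_mk, map_mul, map_mul, map_inv, hy, hh]
  apply scalar_inj (n := n)
  refine (commutatorScalar_spec K _ _ hg' hh').symm.trans
    (Eq.trans ?_ (commutatorScalar_spec K _ _ hg hh))
  have h1 : y * g * y⁻¹ * (y * h * y⁻¹) * (y * g * y⁻¹)⁻¹ * (y * h * y⁻¹)⁻¹ =
      y * (g * h * g⁻¹ * h⁻¹) * y⁻¹ := by group
  rw [h1, commutatorScalar_spec K _ _ hg hh, ← scalar_mul_comm, mul_inv_cancel_right]

/-! ### Consequences of maximality: Schur's lemma, nonsingularity, roots -/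

section Maximality

variable {n : ℕ}

/-- The endomorphism is killed by `X ^ m - 1`, which is separable over `ℂ`. -/
theorem isSemisimple_Ad_of_isOfFinOrder {x : PGL n} (hx : IsOfFinOrder x) :
    (Ad n x).IsSemisimple := by
  obtain ⟨m, hm, h⟩ := isOfFinOrder_iff_pow_eq_one.1 hx
  have hsep : (Polynomial.X ^ m - 1 : Polynomial ℂ).Separable :=
    Polynomial.X_pow_sub_one_separable_iff.2 (by exact_mod_cast hm.ne')
  refine Module.End.isSemisimple_of_squarefree_aeval_eq_zero hsep.squarefree ?_
  rw [map_sub, map_pow, Polynomial.aeval_X, map_one, ← map_pow, h, map_one, sub_self]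

/-- The subgroup generated by an abelian subgroup `K` and an element commuting with `K`. -/
theorem exists_isMulCommutative_extension {G : Type*} [Group G] (K : Subgroup G)
    [IsMulCommutative K] {x : G} (hx : ∀ σ ∈ K, Commute σ x) :
    ∃ K' : Subgroup G, K ≤ K' ∧ x ∈ K' ∧ IsMulCommutative K' ∧
      (Finite K → IsOfFinOrder x → Finite K') := by
  let f : K × Subgroup.zpowers x →* G :=
    MonoidHom.noncommCoprod K.subtype (Subgroup.zpowers x).subtype fun σ y => by
      obtain ⟨_, k, rfl⟩ := y
      exact (hx σ σ.2).zpow_right k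
  refine ⟨f.range, fun σ hσ => ⟨(⟨σ, hσ⟩, 1), by simp [f]⟩,
    ⟨(1, ⟨x, Subgroup.mem_zpowers x⟩), by simp [f]⟩, ⟨⟨?_⟩⟩, fun hK hfin => ?_⟩
  · rintro ⟨_, a, rfl⟩ ⟨_, b, rfl⟩
    apply Subtype.ext
    change f a * f b = f b * f a
    rw [← map_mul, ← map_mul]
    congr 1
    exact Prod.ext (mul_comm' a.1 b.1) (mul_comm' a.2 b.2)
  · have : Finite (Subgroup.zpowers x) := (finite_zpowers.2 hfin).to_subtype
    exact Finite.of_surjective _ f.rangeRestrict_surjective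

variable [NeZero n] {K : Subgroup (PGL n)} [Finite K] [IsMulCommutative K]

/-- `K` and `x` generate a finite abelian group, which is automatically diagonalizable. All other
uses of maximality go through this lemma. -/
theorem mem_of_isOfFinOrder_of_commute (hK : IsMaximalDiagonalizable K) {x : PGL n}
    (hfin : IsOfFinOrder x) (hx : ∀ σ ∈ K, Commute σ x) : x ∈ K := by
  obtain ⟨K', hle, hxK', hcomm, hfin'⟩ := exists_isMulCommutative_extension K hx
  have : Finite K' := hfin' inferInstance hfin
  refine hK.le_of_ge (y := K') ⟨isZariskiClosed_of_finite (Set.toFinite _), hcomm,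
    fun σ hσ => isSemisimple_Ad_of_isOfFinOrder ?_⟩ hle hxK'
  exact Submonoid.isOfFinOrder_coe.2 (isOfFinOrder_of_finite (⟨σ, hσ⟩ : K'))

/-- The homomorphism `z ↦ (1 - e) + z e` attached to an idempotent `e`. -/
def idempotentHom {e : Matrix (Fin n) (Fin n) ℂ} (he : e * e = e) :
    ℂ →* Matrix (Fin n) (Fin n) ℂ where
  toFun z := 1 + (z - 1) • e
  map_one' := by simp
  map_mul' z w := by
    simp only [Matrix.add_mul, Matrix.mul_add, Matrix.one_mul, Matrix.mul_one, Matrix.smul_mul,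
      Matrix.mul_smul, he]
    module

theorem eq_zero_or_eq_one_of_idempotent (hK : IsMaximalDiagonalizable K)
    {e : Matrix (Fin n) (Fin n) ℂ} (he : e * e = e)
    (hc : ∀ g : GL (Fin n) ℂ, proj g ∈ K → g.1 * e = e * g.1) : e = 0 ∨ e = 1 := by
  -- A prime `p > |K|`: an element of `K` killed by `p` is trivial. So `t = 1 + (ω_p - 1) e` is
  -- scalar, and hence so is `e`.
  obtain ⟨p, hpK, hp⟩ := Nat.exists_infinite_primes (Nat.card K + 1)
  have hω := SymplecticAbelian.omega_isPrimitiveRoot hp.ne_zero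
  let t : GL (Fin n) ℂ := Units.map (idempotentHom he) (SymplecticAbelian.omega p)
  have ht : t.1 = 1 + ((SymplecticAbelian.omega p : ℂ) - 1) • e := rfl
  have htp : proj t ^ p = 1 := by
    rw [← map_pow, ← map_pow, hω.pow_eq_one, map_one, map_one]
  have hmem : proj t ∈ K := by
    refine mem_of_isOfFinOrder_of_commute hK
      (isOfFinOrder_iff_pow_eq_one.2 ⟨p, hp.pos, htp⟩) fun σ hσ => ?_
    obtain ⟨g, rfl⟩ := Matrix.ProjGenLinGroup.mk_surjective σ
    have : g * t = t * g := by
      apply Units.ext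
      rw [Units.val_mul, Units.val_mul, ht, Matrix.mul_add, Matrix.add_mul, Matrix.mul_smul,
        Matrix.smul_mul, hc g hσ, Matrix.mul_one, Matrix.one_mul]
    change proj g * proj t = proj t * proj g
    rw [← map_mul, this, map_mul]
  have hone : proj t = proj 1 := by
    have h1 : orderOf (proj t) ∣ p := orderOf_dvd_of_pow_eq_one htp
    have h2 : orderOf (proj t) ∣ Nat.card K := by
      rw [← Subgroup.orderOf_mk (proj t) hmem]
      exact orderOf_dvd_natCard _
    rcases (Nat.dvd_prime hp).1 h1 with h3 | h3
    · rw [map_one, ← orderOf_eq_one_iff, h3]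
    · have := Nat.le_of_dvd Nat.card_pos h2
      omega
  obtain ⟨u, hu⟩ := proj_eq_proj_iff.1 hone.symm
  rw [ht, Units.val_one] at hu
  have hz : (SymplecticAbelian.omega p : ℂ) - 1 ≠ 0 := by
    rw [sub_ne_zero, Ne, Units.val_eq_one]
    exact hω.ne_one hp.one_lt
  obtain ⟨c, rfl⟩ : ∃ c : ℂ, e = c • (1 : Matrix (Fin n) (Fin n) ℂ) := by
    refine ⟨((SymplecticAbelian.omega p : ℂ) - 1)⁻¹ * (u - 1), ?_⟩
    have h1 : ((SymplecticAbelian.omega p : ℂ) - 1) • e =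
        ((u : ℂ) - 1) • (1 : Matrix (Fin n) (Fin n) ℂ) := by
      rw [sub_smul (u : ℂ), ← hu, one_smul, add_sub_cancel_left]
    rw [mul_smul, ← h1, smul_smul, inv_mul_cancel₀ hz, one_smul]
  have h00 := congrFun (congrFun he 0) 0
  simp only [Matrix.mul_smul, Matrix.smul_apply, Matrix.one_apply_eq, smul_eq_mul,
    mul_one] at h00
  rcases eq_or_ne c 0 with h | h
  · left; rw [h, zero_smul]
  · right; rw [mul_left_cancel₀ h (h00.trans (mul_one c).symm), one_smul]

/-- Schur's lemma: a matrix which commutes with the preimage of `K` is scalar. -/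
theorem exists_eq_smul_one_of_commute (hK : IsMaximalDiagonalizable K)
    {y : Matrix (Fin n) (Fin n) ℂ}
    (hc : ∀ g : GL (Fin n) ℂ, proj g ∈ K → g.1 * y = y * g.1) :
    ∃ c : ℂ, y = c • (1 : Matrix (Fin n) (Fin n) ℂ) := by
  obtain ⟨μ, hμ⟩ := Module.End.exists_eigenvalue (Matrix.toLin' y)
  refine ⟨μ, ?_⟩
  -- `p` is a projection onto the `μ`-eigenspace of `y`; the last two conditions say this in terms
  -- of matrices alone.
  obtain ⟨p, hp0, hyp, hfix⟩ : ∃ p : Matrix (Fin n) (Fin n) ℂ, p ≠ 0 ∧ y * p = μ • p ∧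
      ∀ X, y * X = μ • X → p * X = X := by
    set W := Module.End.eigenspace (Matrix.toLin' y) μ
    obtain ⟨W', hW'⟩ := Submodule.exists_isCompl W
    have hmem : ∀ v, v ∈ W ↔ y *ᵥ v = μ • v := fun v => by
      rw [Module.End.mem_eigenspace_iff, Matrix.toLin'_apply]
    let P : Module.End ℂ (Fin n → ℂ) := W.subtype ∘ₗ Submodule.projectionOnto W W' hW'
    have hP : ∀ v, P v ∈ W := fun v => (Submodule.projectionOnto W W' hW' v).2
    have hPW : ∀ v ∈ W, P v = v := fun v hv =>
      congrArg Subtype.val (Submodule.projectionOnto_apply_left hW' ⟨v, hv⟩)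
    have hPm : ∀ v, LinearMap.toMatrix' P *ᵥ v = P v := fun v => by
      rw [LinearMap.toMatrix'_mulVec]
    refine ⟨LinearMap.toMatrix' P, ?_, ?_, fun X hX => ?_⟩
    · obtain ⟨v, hv, hv0⟩ := hμ.exists_hasEigenvector
      intro h
      apply hv0
      rw [← hPW v hv, ← hPm, h, Matrix.zero_mulVec]
    · refine Matrix.ext_of_mulVec_single fun i => ?_
      rw [← Matrix.mulVec_mulVec, Matrix.smul_mulVec, hPm, (hmem _).1 (hP _)]
    · refine Matrix.ext_of_mulVec_single fun i => ?_
      rw [← Matrix.mulVec_mulVec, hPm]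
      apply hPW
      rw [hmem, Matrix.mulVec_mulVec, hX, Matrix.smul_mulVec]
  choose s hs using fun σ : K => Matrix.ProjGenLinGroup.mk_surjective (σ : PGL n)
  have _ : Fintype K := Fintype.ofFinite K
  set N : ℂ := (Fintype.card K : ℂ) with hN
  have hN0 : N ≠ 0 := by simp [hN]
  -- Averaging over `K` works although the lifts `s σ` need not form a group, because conjugation
  -- depends only on the class in `PGL`. The eigenspace is stable under the lifts, so `e` is again a
  -- projection onto it.
  set e : Matrix (Fin n) (Fin n) ℂ := N⁻¹ • ∑ σ : K, (s σ).1 * p * ((s σ)⁻¹).1 with he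
  have hsy : ∀ σ, (s σ).1 * y = y * (s σ).1 := fun σ => hc _ (by
    change Matrix.ProjGenLinGroup.mk (s σ) ∈ K
    rw [hs]; exact σ.2)
  have hsy' : ∀ σ, ((s σ)⁻¹).1 * y = y * ((s σ)⁻¹).1 := fun σ => hc _ (by
    change Matrix.ProjGenLinGroup.mk (s σ)⁻¹ ∈ K
    rw [map_inv, hs]; exact inv_mem σ.2)
  have hye : y * e = μ • e := by
    rw [he, Matrix.mul_smul, smul_comm μ, Finset.mul_sum, Finset.smul_sum (r := μ)]
    congr 1
    refine Finset.sum_congr rfl fun σ _ => ?_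
    rw [← Matrix.mul_assoc, ← Matrix.mul_assoc, ← hsy, Matrix.mul_assoc (s σ).1, hyp,
      Matrix.mul_smul, Matrix.smul_mul]
  have hefix : ∀ X, y * X = μ • X → e * X = X := by
    intro X hX
    have h1 : ∀ σ : K, (s σ).1 * p * ((s σ)⁻¹).1 * X = X := by
      intro σ
      rw [Matrix.mul_assoc, Matrix.mul_assoc, hfix, ← Matrix.mul_assoc, ← Units.val_mul,
        mul_inv_cancel, Units.val_one, Matrix.one_mul]
      rw [← Matrix.mul_assoc, ← hsy', Matrix.mul_assoc, hX, Matrix.mul_smul]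
    rw [he, Matrix.smul_mul, Finset.sum_mul]
    simp only [h1]
    rw [Finset.sum_const, Finset.card_univ, ← Nat.cast_smul_eq_nsmul ℂ, smul_smul,
      inv_mul_cancel₀ hN0, one_smul]
  have hcomm : ∀ g : GL (Fin n) ℂ, proj g ∈ K → g.1 * e = e * g.1 := by
    intro g hg
    have h1 : g.1 * e * (g⁻¹).1 = e := by
      rw [he, Matrix.mul_smul, Matrix.smul_mul, Finset.mul_sum, Finset.sum_mul]
      congr 1
      refine Fintype.sum_equiv (Equiv.mulLeft (⟨proj g, hg⟩ : K)) _ _ fun σ => ?_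
      have h2 : proj (g * s σ) = proj (s (⟨proj g, hg⟩ * σ)) := by
        rw [map_mul]
        change proj g * Matrix.ProjGenLinGroup.mk (s σ) = Matrix.ProjGenLinGroup.mk _
        rw [hs, hs]; rfl
      have h3 := conj_eq_conj_of_proj_eq h2 p
      rw [_root_.mul_inv_rev, Units.val_mul, Units.val_mul] at h3
      rw [Equiv.coe_mulLeft, ← h3]
      simp only [Matrix.mul_assoc]
    calc g.1 * e = g.1 * e * ((g⁻¹).1 * g.1) := by
          rw [← Units.val_mul, inv_mul_cancel, Units.val_one, Matrix.mul_one]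
      _ = e * g.1 := by rw [← Matrix.mul_assoc, h1]
  rcases eq_zero_or_eq_one_of_idempotent hK (hefix e hye) hcomm with h | h
  · exact absurd (by rw [← hefix p hyp, h, Matrix.zero_mul]) hp0
  · rw [h, Matrix.mul_one] at hye
    exact hye

theorem proj_eq_one_of_commute (hK : IsMaximalDiagonalizable K) {y : GL (Fin n) ℂ}
    (hc : ∀ g : GL (Fin n) ℂ, proj g ∈ K → g * y = y * g) : proj y = 1 := by
  obtain ⟨c, hy⟩ := exists_eq_smul_one_of_commute hK (y := y.1)
    fun g hg => congrArg Units.val (hc g hg)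
  have hc0 : c ≠ 0 := by
    rintro rfl
    exact y.ne_zero (by rw [hy, zero_smul])
  rw [← map_one proj, eq_comm, proj_eq_proj_iff]
  exact ⟨Units.mk0 c hc0, hy⟩

theorem commutatorPairing_nonsingular (hK : IsMaximalDiagonalizable K) :
    SymplecticAbelian.IsNonsingular (commutatorPairing K) := by
  intro σ hσ
  obtain ⟨y, hy⟩ := Matrix.ProjGenLinGroup.mk_surjective (σ : PGL n)
  apply Subtype.ext
  rw [← hy]
  refine proj_eq_one_of_commute hK fun g hg => Units.ext ?_
  have h := mul_eq_pairing_smul_mul hy (τ := ⟨proj g, hg⟩) rfl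
  rw [hσ, Units.val_one, one_smul] at h
  exact h.symm

/-- Here `x` may have infinite order. Its pairing with `K` is a character, so it equals `⟨σ₀, ·⟩`
for some `σ₀` in `K`; then `g₀⁻¹ * y` commutes with the preimage of `K` and is scalar. -/
theorem mem_of_commute (hK : IsMaximalDiagonalizable K) {x : PGL n}
    (hx : ∀ σ ∈ K, Commute σ x) : x ∈ K := by
  obtain ⟨K', hle, hxK', hcomm, -⟩ := exists_isMulCommutative_extension K hx
  obtain ⟨σ₀, hσ₀⟩ := (SymplecticAbelian.toCharacter_bijective _
    (commutatorPairing_nonsingular hK)).2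
      ((commutatorPairing K' ⟨x, hxK'⟩).comp (Subgroup.inclusion hle))
  obtain ⟨g₀, hg₀⟩ := Matrix.ProjGenLinGroup.mk_surjective (σ₀ : PGL n)
  obtain ⟨y, rfl⟩ := Matrix.ProjGenLinGroup.mk_surjective x
  have h1 : proj (g₀⁻¹ * y) = 1 := by
    refine proj_eq_one_of_commute hK fun g hg => ?_
    have h2 := commutatorScalar_spec K σ₀ ⟨proj g, hg⟩ hg₀ rfl
    have h3 := commutatorScalar_spec K' ⟨_, hxK'⟩ (Subgroup.inclusion hle ⟨proj g, hg⟩)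
      (g := y) (h := g) rfl rfl
    have h4 : commutatorScalar K σ₀ ⟨proj g, hg⟩ =
        commutatorScalar K' ⟨_, hxK'⟩ (Subgroup.inclusion hle ⟨proj g, hg⟩) :=
      DFunLike.congr_fun hσ₀ ⟨proj g, hg⟩
    rw [h4, ← h3] at h2
    have h5 : g₀ * g * g₀⁻¹ = y * g * y⁻¹ := mul_right_cancel h2
    calc g * (g₀⁻¹ * y) = g₀⁻¹ * (g₀ * g * g₀⁻¹) * y := by group
      _ = g₀⁻¹ * y * g := by rw [h5]; group
  rw [map_mul, map_inv, inv_mul_eq_one] at h1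
  change proj y ∈ K
  rw [← h1]
  change Matrix.ProjGenLinGroup.mk g₀ ∈ K
  rw [hg₀]
  exact σ₀.2

theorem weylAction_injective (hK : IsMaximalDiagonalizable K) :
    Function.Injective (weylAction K) := by
  rw [injective_iff_map_eq_one]
  intro q hq
  induction q using QuotientGroup.induction_on with
  | H x =>
  rw [QuotientGroup.eq_one_iff, Subgroup.mem_subgroupOf]
  refine mem_of_commute hK fun σ hσ => ?_
  have h := weylAction_mk x ⟨σ, hσ⟩
  rw [hq] at h
  exact eq_mul_inv_iff_mul_eq.1 h

/-- All nontrivial characters of `K` are roots. -/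
theorem mem_roots_of_ne_one (hK : IsMaximalDiagonalizable K) {γ : K →* ℂˣ} (hγ : γ ≠ 1) :
    γ ∈ roots K := by
  obtain ⟨b, rfl⟩ := (SymplecticAbelian.toCharacter_bijective _
    (commutatorPairing_nonsingular hK)).2 γ
  -- A lift of `b⁻¹` is the root vector: conjugation by a lift of `σ` scales it by `⟨σ, b⁻¹⟩ = ⟨b,
  -- σ⟩`.
  obtain ⟨g, hg⟩ := Matrix.ProjGenLinGroup.mk_surjective (((b⁻¹ : K)) : PGL n)
  have hconj : ∀ (σ : K) (h : GL (Fin n) ℂ), proj h = σ →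
      h.1 * g.1 * (h⁻¹).1 = (commutatorPairing K b σ : ℂ) • g.1 := by
    intro σ h hh
    have h1 := mul_eq_pairing_smul_mul hh hg
    rw [(commutatorPairing_alternating K).swap σ, map_inv, MonoidHom.inv_apply, inv_inv] at h1
    rw [h1, Matrix.smul_mul, Matrix.mul_assoc, ← Units.val_mul, mul_inv_cancel, Units.val_one,
      Matrix.mul_one]
  -- The trace is invariant under conjugation, yet gets multiplied by some `⟨b, σ⟩ ≠ 1`.
  have htr : g.1.trace = 0 := by
    obtain ⟨σ, hσ⟩ : ∃ σ, commutatorPairing K b σ ≠ 1 := by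
      by_contra! hc
      exact hγ (MonoidHom.ext hc)
    obtain ⟨h, hh⟩ := Matrix.ProjGenLinGroup.mk_surjective (σ : PGL n)
    have h1 := congrArg Matrix.trace (hconj σ h hh)
    rw [Matrix.trace_mul_comm, ← Matrix.mul_assoc, ← Units.val_mul, inv_mul_cancel, Units.val_one,
      Matrix.one_mul, Matrix.trace_smul, smul_eq_mul] at h1
    by_contra h0
    have h2 : (commutatorPairing K b σ : ℂ) = 1 :=
      mul_right_cancel₀ h0 (by rw [one_mul]; exact h1.symm)
    exact hσ (Units.val_eq_one.1 h2)
  intro hbot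
  have hmem : (⟨g.1, (mem_sln _).2 htr⟩ : sln n) ∈ rootSpace K (commutatorPairing K b) := by
    intro σ
    obtain ⟨h, hh⟩ := Matrix.ProjGenLinGroup.mk_surjective (σ : PGL n)
    rw [← hh]
    exact Subtype.ext (hconj σ h hh)
  rw [hbot, Submodule.mem_bot] at hmem
  exact g.ne_zero (congrArg Subtype.val hmem)

end Maximality

end PGLWeyl

namespace PGLWeyl

open Matrix SymplecticAbelian

/-! ### Gauss sums in a matrix of finite order -/

section QuadraticSum

theorem sum_range_add_of_periodic {A : Type*} [AddCommGroup A] {m : ℕ} {F : ℤ → A}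
    (hF : Function.Periodic F m) (j : ℤ) :
    ∑ k ∈ Finset.range m, F (k + j) = ∑ k ∈ Finset.range m, F k := by
  have hstep : ∀ j : ℤ, ∑ k ∈ Finset.range m, F (k + (j + 1)) =
      ∑ k ∈ Finset.range m, F (k + j) := by
    intro j
    have h1 := Finset.sum_range_succ (fun k : ℕ => F (k + j)) m
    rw [Finset.sum_range_succ'] at h1
    have h2 : F ((m : ℤ) + j) = F (((0 : ℕ) : ℤ) + j) := by
      rw [add_comm, hF, Nat.cast_zero, zero_add]
    rw [h2] at h1
    rw [← add_right_cancel h1]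
    refine Finset.sum_congr rfl fun k _ => ?_
    congr 1; push_cast; ring
  induction j with
  | zero => simp
  | succ j ih => rw [hstep, ih]
  | pred j ih => rw [← ih, ← hstep, sub_add_cancel]

/-- The quadratic function `exp (πi k (k + m) / m)`, of period `m` in `k`. -/
noncomputable def quadExp (m : ℕ) (k : ℤ) : ℂ :=
  Complex.exp (Real.pi * Complex.I * (k * (k + m)) / m)

theorem quadExp_ne_zero (m : ℕ) (k : ℤ) : quadExp m k ≠ 0 := Complex.exp_ne_zero _

theorem quadExp_zero (m : ℕ) : quadExp m 0 = 1 := by simp [quadExp]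

variable {m : ℕ}

theorem quadExp_add (k l : ℤ) :
    quadExp m (k + l) = quadExp m k * quadExp m l * (omega m : ℂ) ^ (k * l) := by
  rw [omega, Units.val_mk0, ← Complex.exp_int_mul, quadExp, quadExp, quadExp, ← Complex.exp_add,
    ← Complex.exp_add]
  congr 1
  push_cast
  ring

/-- With `k ^ 2` alone in the exponent the value at `m` would be `(-1) ^ m`; the extra term `k * m`
gives period `m` for odd `m` as well. -/
theorem quadExp_periodic (hm : m ≠ 0) : Function.Periodic (quadExp m) m := by
  intro k
  have h1 : quadExp m m = 1 := by
    have hm' : (m : ℂ) ≠ 0 := by exact_mod_cast hm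
    rw [quadExp, ← Complex.exp_nat_mul_two_pi_mul_I m]
    congr 1
    push_cast
    field_simp
    ring
  have h2 : (omega m : ℂ) ^ (m : ℤ) = 1 := by
    have := (omega_isPrimitiveRoot hm).pow_eq_one
    rw [zpow_natCast, ← Units.val_pow_eq_pow_val, this, Units.val_one]
  rw [quadExp_add, h1, mul_comm k, _root_.zpow_mul, h2, _root_.one_zpow, mul_one, mul_one]

theorem sum_omega_zpow_eq (hm : m ≠ 0) {k : ℕ} (hk : k < m) :
    ∑ l ∈ Finset.range m, (omega m : ℂ) ^ ((k : ℤ) * l) = if k = 0 then (m : ℂ) else 0 := by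
  split_ifs with h0
  · simp [h0]
  · have hω := IsPrimitiveRoot.coe_units_iff.2 (omega_isPrimitiveRoot hm)
    have h1 : (omega m : ℂ) ^ k ≠ 1 := hω.pow_ne_one_of_pos_of_lt h0 hk
    have h2 : ∀ l : ℕ, (omega m : ℂ) ^ ((k : ℤ) * l) = ((omega m : ℂ) ^ k) ^ l := fun l => by
      rw [← pow_mul]; exact_mod_cast rfl
    simp only [h2]
    rw [geom_sum_eq h1, ← pow_mul, mul_comm, pow_mul, hω.pow_eq_one, one_pow, sub_self, zero_div]

variable {n : ℕ}

/-- The sum `∑ k, exp (πi k (k + m) / m) g ^ k` over residues modulo `m`, for `g ^ m = 1`. -/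
noncomputable def quadSum (m : ℕ) (g : GL (Fin n) ℂ) : Matrix (Fin n) (Fin n) ℂ :=
  ∑ k ∈ Finset.range m, quadExp m k • (g ^ (k : ℤ)).1

theorem quadSum_eq_shift (hm : m ≠ 0) {g : GL (Fin n) ℂ} (hg : g ^ m = 1) (j : ℤ) :
    quadSum m g = ∑ k ∈ Finset.range m, quadExp m (k + j) • (g ^ ((k : ℤ) + j)).1 := by
  refine (sum_range_add_of_periodic (F := fun k : ℤ => quadExp m k • (g ^ k).1) (fun k => ?_)
    j).symm
  simp only
  rw [quadExp_periodic hm k, _root_.zpow_add, zpow_natCast, hg, mul_one]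

/-- Completing the square: twisting the coefficients by `ω ^ (k * j)` is the same as shifting `k` by
`j`, up to a constant and a power of `g`. -/
theorem quadSum_eq_smul_mul (hm : m ≠ 0) {g : GL (Fin n) ℂ} (hg : g ^ m = 1) (j : ℤ) :
    ∑ k ∈ Finset.range m, (quadExp m k * (omega m : ℂ) ^ ((k : ℤ) * j)) • (g ^ (k : ℤ)).1 =
      (quadExp m j)⁻¹ • ((g ^ (-j)).1 * quadSum m g) := by
  rw [quadSum_eq_shift hm hg j, Finset.mul_sum, Finset.smul_sum]
  refine Finset.sum_congr rfl fun k _ => ?_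
  rw [Matrix.mul_smul, ← Units.val_mul, ← _root_.zpow_add, smul_smul, quadExp_add]
  congr 1
  · field_simp [quadExp_ne_zero m j]
  · congr 2; ring

/-- Fourier inversion: summed over all twists `l`, only the term `k = 0` survives, and each twisted
sum is a left multiple of `quadSum m g`. -/
theorem isUnit_quadSum (hm : m ≠ 0) {g : GL (Fin n) ℂ} (hg : g ^ m = 1) :
    IsUnit (quadSum m g) := by
  have h1 : (∑ l ∈ Finset.range m, (quadExp m l)⁻¹ • (g ^ (-(l : ℤ))).1) * quadSum m g =
      (m : ℂ) • 1 := by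
    rw [Finset.sum_mul]
    have h2 : ∀ l ∈ Finset.range m, (quadExp m l)⁻¹ • (g ^ (-(l : ℤ))).1 * quadSum m g =
        ∑ k ∈ Finset.range m, (quadExp m k * (omega m : ℂ) ^ ((k : ℤ) * l)) • (g ^ (k : ℤ)).1 :=
      fun l _ => by rw [quadSum_eq_smul_mul hm hg l, Matrix.smul_mul]
    rw [Finset.sum_congr rfl h2, Finset.sum_comm]
    have h3 : ∀ k ∈ Finset.range m, ∑ l ∈ Finset.range m,
        (quadExp m k * (omega m : ℂ) ^ ((k : ℤ) * l)) • (g ^ (k : ℤ)).1 =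
        if k = 0 then (m : ℂ) • (1 : Matrix (Fin n) (Fin n) ℂ) else 0 := by
      intro k hk
      rw [← Finset.sum_smul, ← Finset.mul_sum, sum_omega_zpow_eq hm (Finset.mem_range.1 hk)]
      split_ifs with h0
      · simp [h0, quadExp_zero]
      · simp
    rw [Finset.sum_congr rfl h3, Finset.sum_ite_eq' (Finset.range m) 0,
      if_pos (Finset.mem_range.2 (Nat.pos_of_ne_zero hm))]
  have hm' : (m : ℂ) ≠ 0 := by exact_mod_cast hm
  refine IsUnit.of_mul_eq_one_right
    ((m : ℂ)⁻¹ • ∑ l ∈ Finset.range m, (quadExp m l)⁻¹ • (g ^ (-(l : ℤ))).1) ?_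
  rw [Matrix.smul_mul, h1, smul_smul, inv_mul_cancel₀ hm', one_smul]

theorem zpow_mul_eq_smul {g h : GL (Fin n) ℂ} {z : ℂˣ} (hgh : g.1 * h.1 = (z : ℂ) • (h.1 * g.1))
    (k : ℤ) : (g ^ k).1 * h.1 = ((z ^ k : ℂˣ) : ℂ) • (h.1 * (g ^ k).1) := by
  have h1 : g * h = Matrix.GeneralLinearGroup.scalar (Fin n) z * (h * g) := by
    apply Units.ext
    rw [Units.val_mul, Units.val_mul, coe_scalar_eq_smul_one, hgh, Matrix.smul_mul,
      Matrix.one_mul, Units.val_mul]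
  have h2 : h⁻¹ * g * h = Matrix.GeneralLinearGroup.scalar (Fin n) z * g := by
    rw [mul_assoc, h1, ← mul_assoc, ← scalar_mul_comm]; group
  have h3 : h⁻¹ * g ^ k * h = Matrix.GeneralLinearGroup.scalar (Fin n) (z ^ k) * g ^ k := by
    have := conj_zpow (i := k) (a := h⁻¹) (b := g)
    rw [inv_inv] at this
    rw [← this, h2, (show Commute _ g from scalar_mul_comm z g).mul_zpow, map_zpow]
  have h4 : g ^ k * h = Matrix.GeneralLinearGroup.scalar (Fin n) (z ^ k) * (h * g ^ k) := by
    rw [← mul_assoc, scalar_mul_comm, mul_assoc, ← h3]; group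
  have h5 := congrArg Units.val h4
  rwa [Units.val_mul, Units.val_mul, coe_scalar_eq_smul_one, Matrix.smul_mul, Matrix.one_mul,
    Units.val_mul] at h5

/-- Moving `h` past `g ^ k` produces the twist `ω ^ (j * k)`. So conjugation by the Gauss sum sends
`h` to a multiple of `h * g ^ (-j)`, which is the transvection formula. -/
theorem quadSum_mul_eq (hm : m ≠ 0) {g h : GL (Fin n) ℂ} (hg : g ^ m = 1) {j : ℤ}
    (hgh : g.1 * h.1 = ((omega m ^ j : ℂˣ) : ℂ) • (h.1 * g.1)) :
    quadSum m g * h.1 = (quadExp m j)⁻¹ • (h.1 * (g ^ (-j)).1 * quadSum m g) := by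
  rw [Matrix.mul_assoc, ← Matrix.mul_smul, ← quadSum_eq_smul_mul hm hg j, quadSum,
    Finset.sum_mul, Finset.mul_sum]
  refine Finset.sum_congr rfl fun k _ => ?_
  rw [Matrix.smul_mul, zpow_mul_eq_smul hgh, smul_smul, Matrix.mul_smul, ← _root_.zpow_mul,
    mul_comm j, Units.val_zpow_eq_zpow_val]

end QuadraticSum

/-! ### Transvections as conjugations -/

section TransvectionsInWeylGroup

variable {n : ℕ}

/-- Any lift has a scalar as its `orderOf x`-th power; divide the lift by a root of that scalar. -/
theorem exists_proj_eq_pow_orderOf_eq_one {x : PGL n} (hx : IsOfFinOrder x) :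
    ∃ g : GL (Fin n) ℂ, proj g = x ∧ g ^ orderOf x = 1 := by
  obtain ⟨g, rfl⟩ := Matrix.ProjGenLinGroup.mk_surjective x
  have h1 : proj 1 = proj (g ^ orderOf (proj g)) := by
    rw [map_pow, pow_orderOf_eq_one, map_one]
  obtain ⟨u, hu⟩ := Matrix.ProjGenLinGroup.mk_eq_mk_iff.1 h1
  obtain ⟨v, hv⟩ := IsAlgClosed.exists_pow_nat_eq (u : ℂ) hx.orderOf_pos
  have hv0 : v ≠ 0 := by
    rintro rfl
    rw [zero_pow hx.orderOf_pos.ne'] at hv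
    exact u.ne_zero hv.symm
  have hv' : Units.mk0 v hv0 ^ orderOf (proj g) = u := Units.ext hv
  refine ⟨g * Matrix.GeneralLinearGroup.scalar (Fin n) (Units.mk0 v hv0)⁻¹, ?_, ?_⟩
  · rw [map_mul]
    change _ * Matrix.ProjGenLinGroup.mk _ = _
    rw [Matrix.ProjGenLinGroup.mk_scalar, mul_one]
  · rw [← scalar_mul_comm, (show Commute _ g from scalar_mul_comm _ g).mul_pow]
    change _ * g ^ orderOf (proj g) = 1
    rw [← hu, one_mul, ← map_pow, ← map_mul, inv_pow]
    change Matrix.GeneralLinearGroup.scalar (Fin n) ((Units.mk0 v hv0 ^ orderOf (proj g))⁻¹ * u) = 1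
    rw [hv', inv_mul_cancel, map_one]

variable [NeZero n] (K : Subgroup (PGL n)) [Finite K] [IsMulCommutative K]

theorem transvection_mem_range_weylAction (b : K) :
    transvection (commutatorPairing K) (commutatorPairing_alternating K) b ∈
      (weylAction K).range := by
  set s := transvection (commutatorPairing K) (commutatorPairing_alternating K) b with hs
  have hfin : IsOfFinOrder (b : PGL n) := Submonoid.isOfFinOrder_coe.2 (isOfFinOrder_of_finite b)
  obtain ⟨g, hgb, hg⟩ := exists_proj_eq_pow_orderOf_eq_one hfin
  rw [Subgroup.orderOf_coe] at hg
  have hm := (orderOf_pos b).ne'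
  obtain ⟨X, hX⟩ := isUnit_quadSum hm hg
  have key : ∀ σ : K, proj X * σ * (proj X)⁻¹ = (s σ : PGL n) := by
    intro σ
    obtain ⟨h, hh⟩ := Matrix.ProjGenLinGroup.mk_surjective (σ : PGL n)
    obtain ⟨j, hj⟩ := exists_omega_zpow (commutatorPairing K) b σ
    have h1 := mul_eq_pairing_smul_mul hgb hh
    rw [← hj] at h1
    have h2 := quadSum_mul_eq hm hg h1
    rw [← hX] at h2
    have h3 : proj (X * h) = proj (h * g ^ (-j) * X) := by
      rw [eq_comm, proj_eq_proj_iff]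
      exact ⟨(Units.mk0 _ (quadExp_ne_zero _ j))⁻¹, by
        rw [Units.val_mul, h2, Units.val_inv_eq_inv_val]; rfl⟩
    rw [map_mul, map_mul, map_mul, map_zpow, hgb] at h3
    change proj X * Matrix.ProjGenLinGroup.mk h = Matrix.ProjGenLinGroup.mk h * _ * _ at h3
    rw [hh] at h3
    rw [mul_inv_eq_iff_eq_mul, h3, hs, transvection_apply_of_omega_zpow _ _ hj]
    simp
  have hnorm : proj X ∈ Subgroup.normalizer (K : Set (PGL n)) := by
    rw [Subgroup.mem_normalizer_iff]
    refine fun x => ⟨fun hx => ?_, fun hx => ?_⟩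
    · rw [key ⟨x, hx⟩]; exact (s ⟨x, hx⟩).2
    -- Surjectivity of `s` gives the converse inclusion needed for normalizing `K`.
    · obtain ⟨τ, hτ⟩ := s.surjective ⟨_, hx⟩
      have h1 := key τ
      rw [hτ] at h1
      have h2 := mul_left_cancel (mul_right_cancel h1)
      rw [← h2]
      exact τ.2
  exact ⟨QuotientGroup.mk ⟨proj X, hnorm⟩, MulEquiv.ext fun σ => Subtype.ext (key σ)⟩

end TransvectionsInWeylGroup

end PGLWeyl


theorem theorem6p1 (n : ℕ) [NeZero n] (K : Subgroup (PGLWeyl.PGL n)) [Finite K]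
    [IsMulCommutative K] (hK : PGLWeyl.IsMaximalDiagonalizable K) :
    ∃ hns : SymplecticAbelian.IsNonsingular (PGLWeyl.commutatorPairing K),
      Function.Injective (PGLWeyl.weylAction K) ∧
      (PGLWeyl.weylAction K).range =
        SymplecticAbelian.isometryGroup (PGLWeyl.commutatorPairing K) ∧
      (PGLWeyl.weylAction K).range =
        Subgroup.closure {φ : MulAut K | ∃ γ ∈ PGLWeyl.roots K, γ ≠ 1 ∧
          φ = SymplecticAbelian.transvection (PGLWeyl.commutatorPairing K)
            (PGLWeyl.commutatorPairing_alternating K)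
            (SymplecticAbelian.dualElement (PGLWeyl.commutatorPairing K) hns γ)} := by
  have hns := PGLWeyl.commutatorPairing_nonsingular hK
  have hB := PGLWeyl.commutatorPairing_alternating K
  have hgen := SymplecticAbelian.isometryGroup_eq_transvectionGroup _ hB hns
  have hrange : (PGLWeyl.weylAction K).range =
      SymplecticAbelian.isometryGroup (PGLWeyl.commutatorPairing K) := by
    refine le_antisymm PGLWeyl.weylAction_range_le ?_
    rw [hgen, SymplecticAbelian.transvectionGroup, Subgroup.closure_le]
    rintro _ ⟨b, rfl⟩
    exact PGLWeyl.transvection_mem_range_weylAction K b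
  refine ⟨hns, PGLWeyl.weylAction_injective hK, hrange, ?_⟩
  rw [hrange, hgen]
  apply le_antisymm
  · rw [SymplecticAbelian.transvectionGroup, Subgroup.closure_le]
    rintro _ ⟨b, rfl⟩
    -- Excluding `γ = 1` from the generators loses only the trivial transvection.
    by_cases hb : b = 1
    · rw [hb, SymplecticAbelian.transvection_one]
      exact one_mem _
    · have hne : PGLWeyl.commutatorPairing K b ≠ 1 := fun h =>
        hb (hns b fun a => by rw [h, MonoidHom.one_apply])
      refine Subgroup.subset_closure ⟨_, PGLWeyl.mem_roots_of_ne_one hK hne, hne, ?_⟩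
      congr 1
      exact ((MulEquiv.ofBijective _
        (SymplecticAbelian.toCharacter_bijective _ hns)).symm_apply_apply b).symm
  · rw [Subgroup.closure_le]
    rintro _ ⟨γ, -, -, rfl⟩
    exact SymplecticAbelian.transvection_mem _ hB _
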